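/- For integers $n \ge 2$ and $s \ge 0$, let $\mu_s^{\mathrm{CG}}$ be the distribution of the random $n$-qubit circuit $C = G_s G_{s-1}\cdots G_1 \in \mathrm{U}(2^n)$ of size $s$, where $G_1,\dots,G_s$ are independent and each $G_r$ is obtained by choosing a pair $\{i,j\}$ of distinct qubits uniformly at random among all $\binom n2$ pairs and applying an independent Haar-random gate from $\mathrm{U}(4)$ to the qubits $i,j$. For an $n$-qubit unitary $C$ let $$\mathrm{Coll}(C) = \sum_{x\in\{0,1\}^n} |\langle x|C|0^n\rangle|^4$$ be the collision probability of its output distribution. (1) There is a constant $c>0$ such that for all $n\ge 2$ and all $s > c\, n \ln^2 n$, $$\mathbb{E}_{C\sim\mu_s^{\mathrm{CG}}}\,\mathrm{Coll}(C) \le \frac{29}{2^n}.$$ (2) There is a constant $c_0>0$ such that for all real $c'\ge c_0$, all $n\ge 2$ and all $s \le \frac{1}{3c'}\, n\ln n$, $$\mathbb{E}_{C\sim\mu_s^{\mathrm{CG}}}\,\mathrm{Coll}(C) \ge \frac{1.6^{\,n^{1-1/c'}}}{2^n}.$$ -/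

import Mathlib

open MeasureTheory

noncomputable section

namespace RandomCircuit

/-! ### The unitary group as a compact topological group with its Borel sigma-algebra -/

instance unitaryMeasurableSpace (ι : Type*) [Fintype ι] [DecidableEq ι] :
    MeasurableSpace (Matrix.unitaryGroup ι ℂ) := borel _

instance unitaryBorelSpace (ι : Type*) [Fintype ι] [DecidableEq ι] :
    BorelSpace (Matrix.unitaryGroup ι ℂ) := ⟨rfl⟩

instance unitaryCompactSpace (ι : Type*) [Fintype ι] [DecidableEq ι] :
    CompactSpace (Matrix.unitaryGroup ι ℂ) := by
  have hK : IsCompact (Set.pi Set.univ fun _ : ι => Set.pi Set.univ fun _ : ι =>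
      Metric.closedBall (0 : ℂ) 1) :=
    isCompact_univ_pi fun _ => isCompact_univ_pi fun _ => isCompact_closedBall 0 1
  have hcl : IsClosed {A : Matrix ι ι ℂ | star A * A = 1 ∧ A * star A = 1} := by
    apply IsClosed.and
    · exact isClosed_eq (by fun_prop) continuous_const
    · exact isClosed_eq (by fun_prop) continuous_const
  suffices h : IsCompact {A : Matrix ι ι ℂ | A ∈ Matrix.unitaryGroup ι ℂ} from
    isCompact_iff_compactSpace.mp h
  refine hK.of_isClosed_subset hcl ?_
  intro A hA i _ j _
  simpa using entry_norm_bound_of_unitary hA i j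

/-- The Haar probability measure on the unitary group `U(ι)`: the (left-invariant) Haar measure
that gives the whole compact group mass `1`. -/
def haarUnitary (ι : Type*) [Fintype ι] [DecidableEq ι] : Measure (Matrix.unitaryGroup ι ℂ) :=
  Measure.haarMeasure ⊤

/-! ### Circuits on `n` qubits -/

/-- Bit strings of length `n`; they label the computational basis of `n` qubits. -/
abbrev BitString (n : ℕ) : Type := Fin n → Fin 2

/-- The unitary group `U(2 ^ n)` of `n` qubits, written in the computational basis. -/
abbrev QubitUnitary (n : ℕ) : Type := Matrix.unitaryGroup (BitString n) ℂ

/-- The group `U(4)` of two-qubit gates, written in the computational basis `|a b⟩`. -/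
abbrev TwoQubitGate : Type := Matrix.unitaryGroup (Fin 2 × Fin 2) ℂ

/-- The operator on `n` qubits which acts as the `4 × 4` matrix `U` on the qubits `i` and `j`, and
as the identity on the other qubits. -/
def gateMatrix {n : ℕ} (i j : Fin n) (U : Matrix (Fin 2 × Fin 2) (Fin 2 × Fin 2) ℂ) :
    Matrix (BitString n) (BitString n) ℂ :=
  fun x y => if ∀ k, k ≠ i → k ≠ j → x k = y k then U (x i, x j) (y i, y j) else 0

theorem gateMatrix_one {n : ℕ} (i j : Fin n) : gateMatrix i j 1 = 1 := by
  ext x y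
  simp only [gateMatrix, Matrix.one_apply, Prod.mk.injEq]
  by_cases hxy : x = y
  · subst hxy; simp
  · rw [if_neg hxy]
    split_ifs with h1 h2
    · refine absurd (funext fun k => ?_) hxy
      by_cases hi : k = i
      · rw [hi]; exact h2.1
      by_cases hj : k = j
      · rw [hj]; exact h2.2
      exact h1 k hi hj
    · rfl
    · rfl

theorem gateMatrix_star {n : ℕ} (i j : Fin n) (U : Matrix (Fin 2 × Fin 2) (Fin 2 × Fin 2) ℂ) :
    gateMatrix i j (star U) = star (gateMatrix i j U) := by
  ext x y
  simp only [gateMatrix, Matrix.star_apply]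
  have : (∀ k, k ≠ i → k ≠ j → x k = y k) ↔ (∀ k, k ≠ i → k ≠ j → y k = x k) :=
    ⟨fun h k a b => (h k a b).symm, fun h k a b => (h k a b).symm⟩
  by_cases h : ∀ k, k ≠ i → k ≠ j → x k = y k
  · rw [if_pos h, if_pos (this.1 h)]
  · rw [if_neg h, if_neg (fun h' => h (this.2 h')), star_zero]

theorem gateMatrix_mul {n : ℕ} {i j : Fin n} (hij : i ≠ j)
    (U V : Matrix (Fin 2 × Fin 2) (Fin 2 × Fin 2) ℂ) :
    gateMatrix i j (U * V) = gateMatrix i j U * gateMatrix i j V := by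
  ext x z
  set g : Fin 2 × Fin 2 → BitString n :=
    fun a => Function.update (Function.update x i a.1) j a.2 with hg
  have gi : ∀ a, g a i = a.1 := fun a => by simp [hg, hij]
  have gj : ∀ a, g a j = a.2 := fun a => by simp [hg]
  have gk : ∀ a k, k ≠ i → k ≠ j → g a k = x k := fun a k h1 h2 => by simp [hg, h1, h2]
  have ginj : Function.Injective g := fun a b h =>
    Prod.ext (by rw [← gi a, h, gi]) (by rw [← gj a, h, gj])
  rw [Matrix.mul_apply]
  have key : ∑ a, gateMatrix i j U x (g a) * gateMatrix i j V (g a) z =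
      ∑ y, gateMatrix i j U x y * gateMatrix i j V y z := by
    refine Fintype.sum_of_injective g ginj _ _ (fun y hy => ?_) (fun _ => rfl)
    have : gateMatrix i j U x y = 0 := by
      refine if_neg fun h => hy ⟨(y i, y j), funext fun k => ?_⟩
      by_cases hi : k = i
      · rw [hi, gi]
      by_cases hj : k = j
      · rw [hj, gj]
      rw [gk _ k hi hj, h k hi hj]
    rw [this, zero_mul]
  rw [← key]
  have e1 : ∀ a, gateMatrix i j U x (g a) = U (x i, x j) a := fun a => by
    have h : ∀ k, k ≠ i → k ≠ j → x k = g a k := fun k h1 h2 => (gk a k h1 h2).symm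
    simp only [gateMatrix, if_pos h, gi, gj]
  by_cases h : ∀ k, k ≠ i → k ≠ j → x k = z k
  · have e2 : ∀ a, gateMatrix i j V (g a) z = V a (z i, z j) := fun a => by
      have h' : ∀ k, k ≠ i → k ≠ j → g a k = z k := fun k h1 h2 => by rw [gk a k h1 h2, h k h1 h2]
      simp only [gateMatrix, if_pos h', gi, gj]
    simp only [e1, e2]
    simp only [gateMatrix, if_pos h, Matrix.mul_apply]
  · have e2 : ∀ a, gateMatrix i j V (g a) z = 0 := fun a =>
      if_neg fun h' => h fun k h1 h2 => by rw [← gk a k h1 h2, h' k h1 h2]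
    simp only [e2, mul_zero, Finset.sum_const_zero]
    exact if_neg h

/-- The unordered pairs of distinct qubits, each listed as `(i, j)` with `i < j`. -/
abbrev QubitPair (n : ℕ) : Type := {p : Fin n × Fin n // p.1 < p.2}

/-- The two-qubit gate `U` applied to the pair `p` of qubits, as a unitary on all `n` qubits. -/
def applyGate {n : ℕ} (p : QubitPair n) (U : TwoQubitGate) : QubitUnitary n :=
  ⟨gateMatrix p.1.1 p.1.2 U.1, by
    have hij := ne_of_lt p.2
    constructor
    · rw [← gateMatrix_star, ← gateMatrix_mul hij, U.2.1, gateMatrix_one]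
    · rw [← gateMatrix_star, ← gateMatrix_mul hij, U.2.2, gateMatrix_one]⟩

/-- The law of one random step: a uniformly random pair of distinct qubits, with a Haar-random gate
from `U(4)` on it (the uniform mixture over the `n (n - 1) / 2` pairs). -/
def stepLaw (n : ℕ) : Measure (QubitUnitary n) :=
  (Fintype.card (QubitPair n) : ENNReal)⁻¹ •
    ∑ p : QubitPair n, (haarUnitary (Fin 2 × Fin 2)).map (applyGate p)

/-- The law of the random circuit of size `s` on the complete graph of `n` qubits: the product of
`s` independent random steps, where each new gate multiplies the circuit from the left. -/
def circuitLaw (n : ℕ) : ℕ → Measure (QubitUnitary n)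
  | 0 => Measure.dirac 1
  | s + 1 => (stepLaw n).mconv (circuitLaw n s)

/-- The collision probability `∑ x, |⟨x|C|0ⁿ⟩|⁴` of the output distribution of the circuit `C`
on the input `|0ⁿ⟩`. -/
def coll {n : ℕ} (C : QubitUnitary n) : ℝ := ∑ x : BitString n, ‖C.1 x 0‖ ^ 4

/-- The expected collision probability of a random circuit of size `s` on `n` qubits. -/
def expectedColl (n s : ℕ) : ℝ := ∫ C, coll C ∂(circuitLaw n s)

end RandomCircuit

end

namespace RandomCircuit

/-! ### Integration over unitary groups -/

/-! The collision probability is quadratic in C|0⟩⟨0|C†: it is the expectation, in two copies of the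
state, of a product over qubits of the projection onto equal basis states (`replicaSum_diag`).
Averaging a Haar gate on two qubits sends every product observable there to a combination of
identity⊗identity and swap⊗swap (`haarMoment_eq`, `integral_replicaSum_gate`). So each qubit carries
a label `keep`, `swap` or `diag`. Peeling off the last gate first gives a linear recursion with
nonnegative coefficients on functions of the labels, started at the constant 1
(`integral_replicaSum`), and the quantity sought is its value at all-`diag` (`expectedColl_eq`).
Positivity makes the recursion monotone, so a pointwise bound by a product weight at size s yields
one at size s + 1 as soon as a single averaged step is controlled.

Lower bound: the weight with factors 1, 1/2, 1/2 is invariant, being the expectation in the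
maximally mixed state. Raising the `diag` factor to e^L/2 costs e^(-L) for each `diag` site hit by a
gate; by convexity, averaging over pairs replaces L by at most the loss L ↦ (1 - 2/n)L. From L = log
2 this gives 2^(n(1-2/n)^s)/2^n (`two_rpow_le_labelValue`), so 2 may stand where the theorem has
1.6.

Upper bound: all-`keep` and all-`swap` are absorbing with value 1, so the comparison function is a
sum of two weights, (a^#swap + a^#keep) b^#diag. With b = 1, gates on unequal labels push a from 1 -
1/(n+2) towards 1/2 along a discrete logistic curve (`labelValue_succ_le_branchWeight`,
`labelValue_le_branchBase`). Then a is frozen and b relaxes to (1 + a)/3 at rate 1/n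
(`labelValue_succ_le_branchWeight_diag`). Each stage takes O(n log n) gates to come within O(1/n) of
1/2, and 2(1/2 + 1/n)^n is O(2^(-n)). -/

instance unitarySecondCountable (ι : Type*) [Fintype ι] [DecidableEq ι] :
    SecondCountableTopology (Matrix.unitaryGroup ι ℂ) := by
  have : SecondCountableTopology (Matrix ι ι ℂ) :=
    inferInstanceAs (SecondCountableTopology (ι → ι → ℂ))
  exact TopologicalSpace.Subtype.secondCountableTopology
    (fun A : Matrix ι ι ℂ => A ∈ Matrix.unitaryGroup ι ℂ)

instance haarUnitary_isProbabilityMeasure (ι : Type*) [Fintype ι] [DecidableEq ι] :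
    IsProbabilityMeasure (haarUnitary ι) :=
  ⟨by simpa [haarUnitary] using
    Measure.haarMeasure_self (K₀ := (⊤ : TopologicalSpace.PositiveCompacts
      (Matrix.unitaryGroup ι ℂ)))⟩

instance haarUnitary_isMulLeftInvariant (ι : Type*) [Fintype ι] [DecidableEq ι] :
    Measure.IsMulLeftInvariant (haarUnitary ι) := by
  unfold haarUnitary; infer_instance

theorem integrable_of_continuous {ι : Type*} [Fintype ι] [DecidableEq ι]
    (μ : Measure (Matrix.unitaryGroup ι ℂ)) [IsFiniteMeasure μ]
    {f : Matrix.unitaryGroup ι ℂ → ℂ} (hf : Continuous f) : Integrable f μ :=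
  hf.integrable_of_hasCompactSupport (HasCompactSupport.of_compactSpace f)

theorem continuous_entry {ι : Type*} [Fintype ι] [DecidableEq ι] (x y : ι) :
    Continuous fun U : Matrix.unitaryGroup ι ℂ => U.1 x y :=
  continuous_subtype_val.matrix_elem x y

/-! ### Four replicas of an index -/

/-- Entries of the first two replicas are taken as they are, those of the last two are
conjugated. -/
def replicaHom (r : Fin 4) : ℂ →+* ℂ := if r < 2 then RingHom.id ℂ else starRingEnd ℂ

theorem continuous_replicaHom (r : Fin 4) : Continuous (replicaHom r) := by
  unfold replicaHom
  split_ifs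
  · exact continuous_id
  · exact Complex.continuous_conj

theorem prod_replicaHom (f : Fin 4 → ℂ) :
    ∏ r, replicaHom r (f r) = f 0 * f 1 * star (f 2) * star (f 3) := by
  simp [Fin.prod_univ_four, replicaHom]

theorem sum_replicas {ι M : Type*} [Fintype ι] [DecidableEq ι] [AddCommMonoid M]
    (f : (Fin 4 → ι) → M) :
    ∑ a, f a = ∑ x, ∑ y, ∑ u, ∑ v, f ![x, y, u, v] := by
  let e : ι × ι × ι × ι ≃ (Fin 4 → ι) :=
    { toFun := fun p => ![p.1, p.2.1, p.2.2.1, p.2.2.2]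
      invFun := fun a => (a 0, a 1, a 2, a 3)
      left_inv := fun p => rfl
      right_inv := fun a => by ext r; fin_cases r <;> rfl }
  rw [← e.sum_comp]
  simp only [Fintype.sum_prod_type]
  rfl

/-- The matrix elements of the identity of two copies, as a function of four replicas. -/
def idTensor {ι : Type*} [DecidableEq ι] (a : Fin 4 → ι) : ℝ :=
  if a 0 = a 2 ∧ a 1 = a 3 then 1 else 0

/-- The matrix elements of the swap of two copies, as a function of four replicas. -/
def swapTensor {ι : Type*} [DecidableEq ι] (a : Fin 4 → ι) : ℝ :=
  if a 0 = a 3 ∧ a 1 = a 2 then 1 else 0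

/-- The indicator function of four equal replicas. -/
def diagTensor {ι : Type*} [DecidableEq ι] (a : Fin 4 → ι) : ℝ :=
  if a 0 = a 1 ∧ a 1 = a 2 ∧ a 2 = a 3 then 1 else 0

section Contraction

variable {ι : Type*} [Fintype ι] [DecidableEq ι] {A : ι → ι → ℂ}

/-- Invariance of the identity of two copies under A ⊗ A ⊗ Ā ⊗ Ā. Only row orthonormality is
assumed, so it serves both for a unitary and for its transpose. -/
theorem sum_idTensor (hA : ∀ x x', ∑ y, A x y * star (A x' y) = if x = x' then 1 else 0)
    (a : Fin 4 → ι) :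
    ∑ b : Fin 4 → ι, (∏ r, replicaHom r (A (a r) (b r))) * (idTensor b : ℂ) = idTensor a := by
  have h1 : ∀ b : Fin 4 → ι, (∏ r, replicaHom r (A (a r) (b r))) * (idTensor b : ℂ) =
      if b 0 = b 2 then (if b 1 = b 3 then
        A (a 0) (b 0) * A (a 1) (b 1) * star (A (a 2) (b 2)) * star (A (a 3) (b 3)) else 0)
        else 0 := by
    intro b
    rw [prod_replicaHom]
    by_cases h : b 0 = b 2 <;> by_cases h' : b 1 = b 3 <;> simp [idTensor, h, h']
  rw [Finset.sum_congr rfl fun b _ => h1 b]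
  calc _ = ∑ x, ∑ y, ∑ u, ∑ v, if x = u then (if y = v then
        A (a 0) x * A (a 1) y * star (A (a 2) u) * star (A (a 3) v) else 0) else 0 := by
        rw [sum_replicas]; rfl
    _ = ∑ x, ∑ y, (A (a 0) x * star (A (a 2) x)) * (A (a 1) y * star (A (a 3) y)) := by
        refine Finset.sum_congr rfl fun x _ => Finset.sum_congr rfl fun y _ => ?_
        rw [Finset.sum_eq_single x (fun u _ hu => by simp [Ne.symm hu]) (by simp),
          Finset.sum_eq_single y (fun v _ hv => by simp [Ne.symm hv]) (by simp),
          if_pos rfl, if_pos rfl]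
        ring
    _ = idTensor a := by
        simp only [← Finset.mul_sum, ← Finset.sum_mul, hA]
        by_cases h : a 0 = a 2 <;> by_cases h' : a 1 = a 3 <;> simp [idTensor, h, h']

theorem sum_swapTensor (hA : ∀ x x', ∑ y, A x y * star (A x' y) = if x = x' then 1 else 0)
    (a : Fin 4 → ι) :
    ∑ b : Fin 4 → ι, (∏ r, replicaHom r (A (a r) (b r))) * (swapTensor b : ℂ) =
      swapTensor a := by
  have h1 := sum_idTensor hA (a ∘ Equiv.swap 2 3)
  rw [← (Equiv.arrowCongr (Equiv.swap (2 : Fin 4) 3) (Equiv.refl ι)).sum_comp] at h1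
  convert h1 using 3 with b
  · rw [prod_replicaHom, prod_replicaHom]
    have e1 : (Equiv.swap (2 : Fin 4) 3) 0 = 0 := by decide
    have e2 : (Equiv.swap (2 : Fin 4) 3) 1 = 1 := by decide
    simp [e1, e2]
    ring
  · have e1 : (Equiv.swap (2 : Fin 4) 3) 0 = 0 := by decide
    have e2 : (Equiv.swap (2 : Fin 4) 3) 1 = 1 := by decide
    simp [idTensor, swapTensor, e1, e2]
  · have e1 : (Equiv.swap (2 : Fin 4) 3) 0 = 0 := by decide
    have e2 : (Equiv.swap (2 : Fin 4) 3) 1 = 1 := by decide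
    simp [idTensor, swapTensor, e1, e2]

end Contraction

theorem row_orthonormal {ι : Type*} [Fintype ι] [DecidableEq ι] (U : Matrix.unitaryGroup ι ℂ)
    (x x' : ι) : ∑ y, U.1 x y * star (U.1 x' y) = if x = x' then 1 else 0 := by
  have := congrFun (congrFun U.2.2 x) x'
  simpa [Matrix.mul_apply, Matrix.star_apply, Matrix.one_apply] using this

theorem column_orthonormal {ι : Type*} [Fintype ι] [DecidableEq ι] (U : Matrix.unitaryGroup ι ℂ)
    (x x' : ι) : ∑ y, U.1 y x * star (U.1 y x') = if x = x' then 1 else 0 := by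
  have := congrFun (congrFun U.2.1 x') x
  rw [Matrix.mul_apply] at this
  simp only [Matrix.star_apply, Matrix.one_apply] at this
  simp_rw [mul_comm (U.1 _ x), this, eq_comm]

/-! ### Second moments of the Haar measure -/

/-- The moment `E[U(a₀,b₀) U(a₁,b₁) conj U(a₂,b₂) conj U(a₃,b₃)]` of a Haar-random unitary. -/
noncomputable def haarMoment {ι : Type*} [Fintype ι] [DecidableEq ι] (a b : Fin 4 → ι) : ℂ :=
  ∫ U : Matrix.unitaryGroup ι ℂ, ∏ r, replicaHom r (U.1 (a r) (b r)) ∂haarUnitary ι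

theorem continuous_replicas {ι : Type*} [Fintype ι] [DecidableEq ι] (a b : Fin 4 → ι) :
    Continuous fun U : Matrix.unitaryGroup ι ℂ => ∏ r, replicaHom r (U.1 (a r) (b r)) :=
  continuous_finsetProd _ fun r _ => (continuous_replicaHom r).comp (continuous_entry _ _)

theorem prod_replicaHom_mul {ι κ : Type*} [Fintype ι] [DecidableEq ι] (A : κ → ι → ℂ)
    (B : Fin 4 → ι → ℂ) (a : Fin 4 → κ) :
    ∏ r, replicaHom r (∑ y, A (a r) y * B r y) =
      ∑ c : Fin 4 → ι, (∏ r, replicaHom r (A (a r) (c r))) * ∏ r, replicaHom r (B r (c r)) := by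
  simp only [map_sum, map_mul]
  rw [Finset.prod_univ_sum, Fintype.piFinset_univ]
  simp only [Finset.prod_mul_distrib]

/-- Left invariance of Haar measure. Everything about the moments comes from choosing V here: a
permutation, a diagonal phase, a rotation. -/
theorem haarMoment_mul {ι : Type*} [Fintype ι] [DecidableEq ι] (V : Matrix.unitaryGroup ι ℂ)
    (a b : Fin 4 → ι) :
    haarMoment a b = ∑ c, (∏ r, replicaHom r (V.1 (a r) (c r))) * haarMoment c b := by
  unfold haarMoment
  rw [← integral_mul_left_eq_self _ V]
  simp_rw [← integral_const_mul]
  rw [← integral_finsetSum]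
  · refine integral_congr_ae (Filter.Eventually.of_forall fun U => ?_)
    simp only [Submonoid.coe_mul, Matrix.mul_apply]
    exact prod_replicaHom_mul V.1 (fun r y => U.1 y (b r)) a
  · intro c _
    exact (integrable_of_continuous _ (continuous_replicas c b)).const_mul _

theorem haarMoment_perm {ι : Type*} [Fintype ι] [DecidableEq ι] (π : Equiv.Perm ι)
    (a b : Fin 4 → ι) : haarMoment a b = haarMoment (fun r => π (a r)) b := by
  let V : Matrix.unitaryGroup ι ℂ := ⟨Matrix.of fun x y => if y = π x then 1 else 0, by
    rw [Matrix.mem_unitaryGroup_iff]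
    ext x x'
    rw [Matrix.mul_apply]
    simp only [Matrix.star_apply, Matrix.one_apply]
    simp [apply_ite, eq_comm]⟩
  rw [haarMoment_mul V, Finset.sum_eq_single (fun r => π (a r))]
  · simp [V]
  · intro c _ hc
    obtain ⟨r, hr⟩ := Function.ne_iff.1 hc
    rw [Finset.prod_eq_zero (Finset.mem_univ r), zero_mul]
    simp [V, hr]
  · simp

theorem haarMoment_phase {ι : Type*} [Fintype ι] [DecidableEq ι] (e : ι)
    (a b : Fin 4 → ι) :
    haarMoment a b =
      (∏ r, replicaHom r (if a r = e then Complex.I else 1)) * haarMoment a b := by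
  let V : Matrix.unitaryGroup ι ℂ :=
    ⟨Matrix.diagonal fun x => if x = e then Complex.I else 1, by
      rw [Matrix.mem_unitaryGroup_iff, Matrix.star_eq_conjTranspose,
        Matrix.diagonal_conjTranspose, Matrix.diagonal_mul_diagonal, ← Matrix.diagonal_one]
      congr 1
      ext x
      by_cases h : x = e <;> simp [h]⟩
  conv_lhs => rw [haarMoment_mul V]
  rw [Finset.sum_eq_single a]
  · simp [V]
  · intro c _ hc
    obtain ⟨r, hr⟩ := Function.ne_iff.1 hc
    rw [Finset.prod_eq_zero (Finset.mem_univ r), zero_mul]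
    simp [V, Matrix.diagonal_apply_ne _ (Ne.symm hr)]
  · simp

/-- Phase invariance at each basis element forces the unconjugated indices and the conjugated ones
to agree as multisets. -/
theorem haarMoment_eq_zero {ι : Type*} [Fintype ι] [DecidableEq ι] {a : Fin 4 → ι}
    (b : Fin 4 → ι) (h₁ : ¬(a 0 = a 2 ∧ a 1 = a 3)) (h₂ : ¬(a 0 = a 3 ∧ a 1 = a 2)) :
    haarMoment a b = 0 := by
  by_contra hM
  have h : ∀ e, (∏ r, replicaHom r (if a r = e then Complex.I else 1)) = 1 := fun e =>
    mul_right_cancel₀ hM (by rw [one_mul, ← haarMoment_phase])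
  simp only [prod_replicaHom] at h
  -- The product is a power of i whose exponent lies between -2 and 2, so it equals 1 only for
  -- exponent 0; one phase i therefore suffices.
  have key : ∀ (P Q R S : Prop) [Decidable P] [Decidable Q] [Decidable R] [Decidable S],
      (if P then Complex.I else 1) * (if Q then Complex.I else 1) *
        star (if R then Complex.I else 1) * star (if S then Complex.I else 1) = 1 →
      ((if P then 1 else 0) + (if Q then 1 else 0) : ℕ) =
        (if R then 1 else 0) + (if S then 1 else 0) := by
    intro P Q R S _ _ _ _
    by_cases hP : P <;> by_cases hQ : Q <;> by_cases hR : R <;> by_cases hS : S <;>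
      simp [hP, hQ, hR, hS, Complex.ext_iff] <;> norm_num
  have c0 := key _ _ _ _ (h (a 0))
  have c1 := key _ _ _ _ (h (a 1))
  clear h key hM
  grind

theorem exists_perm_of_ne {ι : Type*} [DecidableEq ι] {x y x' y' : ι} (h : x ≠ y)
    (h' : x' ≠ y') : ∃ π : Equiv.Perm ι, π x = x' ∧ π y = y' := by
  refine ⟨(Equiv.swap x x').trans (Equiv.swap (Equiv.swap x x' y) y'), ?_, ?_⟩
  · rw [Equiv.trans_apply, Equiv.swap_apply_left]
    refine Equiv.swap_apply_of_ne_of_ne (fun hc => h ?_) h'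
    rw [← (Equiv.swap x x').injective.eq_iff, Equiv.swap_apply_left]
    exact hc
  · rw [Equiv.trans_apply, Equiv.swap_apply_left]

/-- By permutation invariance the moment depends only on the equality pattern of `a`, and three
patterns survive: paired as identity, paired as swap, all equal. -/
theorem haarMoment_eq_three_terms {ι : Type*} [Fintype ι] [DecidableEq ι] {x y : ι}
    (hxy : x ≠ y) (a b : Fin 4 → ι) :
    haarMoment a b = haarMoment ![x, y, x, y] b * idTensor a +
      haarMoment ![x, y, y, x] b * swapTensor a +
      (haarMoment (fun _ => x) b - haarMoment ![x, y, x, y] b - haarMoment ![x, y, y, x] b) *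
        diagTensor a := by
  by_cases h01 : a 0 = a 1
  · by_cases h : a 1 = a 2 ∧ a 2 = a 3
    · have : haarMoment a b = haarMoment (fun _ => x) b := by
        rw [haarMoment_perm (Equiv.swap (a 0) x)]
        congr 1
        ext r
        fin_cases r <;> simp [h01, h.1, h.2]
      rw [this]
      simp [idTensor, swapTensor, diagTensor, h01, h.1, h.2]
    · rw [haarMoment_eq_zero]
      · have e1 : ¬(a 0 = a 2 ∧ a 1 = a 3) := by grind
        have e2 : ¬(a 0 = a 3 ∧ a 1 = a 2) := by grind
        have e3 : ¬(a 0 = a 1 ∧ a 1 = a 2 ∧ a 2 = a 3) := by grind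
        simp only [idTensor, swapTensor, diagTensor, if_neg e1, if_neg e2, if_neg e3]
        simp
      · grind
      · grind
  · obtain ⟨π, hx, hy⟩ := exists_perm_of_ne h01 hxy
    have e3 : ¬(a 0 = a 1 ∧ a 1 = a 2 ∧ a 2 = a 3) := by grind
    by_cases h1 : a 0 = a 2 ∧ a 1 = a 3
    · have e2 : ¬(a 0 = a 3 ∧ a 1 = a 2) := by grind
      have : haarMoment a b = haarMoment ![x, y, x, y] b := by
        rw [haarMoment_perm π]
        congr 1
        ext r
        fin_cases r <;> simp [hx, hy, ← h1.1, ← h1.2]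
      rw [this]
      simp only [idTensor, swapTensor, diagTensor, if_pos h1, if_neg e2, if_neg e3]
      simp
    · by_cases h2 : a 0 = a 3 ∧ a 1 = a 2
      · have : haarMoment a b = haarMoment ![x, y, y, x] b := by
          rw [haarMoment_perm π]
          congr 1
          ext r
          fin_cases r <;> simp [hx, hy, ← h2.1, ← h2.2]
        rw [this]
        simp only [idTensor, swapTensor, diagTensor, if_neg h1, if_pos h2, if_neg e3]
        simp
      · rw [haarMoment_eq_zero b h1 h2]
        simp only [idTensor, swapTensor, diagTensor, if_neg h1, if_neg h2, if_neg e3]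
        simp

/-- A real rotation of the first of two qubits. -/
noncomputable def rotation : TwoQubitGate :=
  ⟨Matrix.kroneckerMap (· * ·) !![3 / 5, 4 / 5; -4 / 5, 3 / 5] 1, by
    refine Matrix.kronecker_mem_unitary ?_ (one_mem _)
    rw [Matrix.mem_unitaryGroup_iff]
    ext i j
    fin_cases i <;> fin_cases j <;>
      simp [Matrix.mul_apply, Fin.sum_univ_two, Matrix.star_apply, Complex.conj_ofNat] <;>
      norm_num⟩

theorem sum_diagTensor {ι : Type*} [Fintype ι] [DecidableEq ι] (f : (Fin 4 → ι) → ℂ) :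
    ∑ c, f c * (diagTensor c : ℂ) = ∑ y, f fun _ => y := by
  have : ∀ c ∉ Set.range (fun (y : ι) (_ : Fin 4) => y), f c * (diagTensor c : ℂ) = 0 := by
    intro c hc
    have : ¬(c 0 = c 1 ∧ c 1 = c 2 ∧ c 2 = c 3) := by
      rintro ⟨h1, h2, h3⟩
      refine hc ⟨c 0, ?_⟩
      ext r
      fin_cases r <;> simp [h1, h2, h3]
    simp [diagTensor, this]
  exact (Fintype.sum_of_injective (fun (y : ι) (_ : Fin 4) => y)
    (fun _ _ h => congrFun h 0) _ _ this fun y => by simp [diagTensor]).symm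

/-- Permutations and phases cannot exclude the `diagTensor` term; a rotation does, since it fixes
the other two tensors but not this one. -/
theorem haarMoment_eq_two_terms (a b : Fin 4 → Fin 2 × Fin 2) :
    haarMoment a b = haarMoment ![(0, 0), (1, 0), (0, 0), (1, 0)] b * idTensor a +
      haarMoment ![(0, 0), (1, 0), (1, 0), (0, 0)] b * swapTensor a := by
  have hne : ((0, 0) : Fin 2 × Fin 2) ≠ (1, 0) := by decide
  set q := haarMoment ![(0, 0), (1, 0), (0, 0), (1, 0)] b with hq
  set r := haarMoment ![(0, 0), (1, 0), (1, 0), (0, 0)] b with hr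
  obtain ⟨κ, hκ⟩ : ∃ κ, κ = haarMoment (fun _ => ((0, 0) : Fin 2 × Fin 2)) b - q - r := ⟨_, rfl⟩
  have h3 : ∀ a, haarMoment a b = q * idTensor a + r * swapTensor a + κ * diagTensor a :=
    fun a => by rw [hκ, haarMoment_eq_three_terms hne]
  suffices κ = 0 by rw [h3, this]; ring
  have h4 := haarMoment_mul rotation (fun _ => ((0, 0) : Fin 2 × Fin 2)) b
  have hA := row_orthonormal rotation
  have hI := sum_idTensor hA (fun _ => (0, 0))
  have hS := sum_swapTensor hA (fun _ => (0, 0))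
  have hD := sum_diagTensor fun c => ∏ s, replicaHom s (rotation.1 (0, 0) (c s))
  have h5 : ∀ c : Fin 4 → Fin 2 × Fin 2,
      (∏ s, replicaHom s (rotation.1 (0, 0) (c s))) * haarMoment c b =
      q * ((∏ s, replicaHom s (rotation.1 (0, 0) (c s))) * idTensor c) +
      r * ((∏ s, replicaHom s (rotation.1 (0, 0) (c s))) * swapTensor c) +
      κ * ((∏ s, replicaHom s (rotation.1 (0, 0) (c s))) * diagTensor c) := fun c => by
    rw [h3]; ring
  simp only [h5, Finset.sum_add_distrib, ← Finset.mul_sum] at h4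
  rw [hI, hS, hD, h3] at h4
  simp only [prod_replicaHom, rotation, Fintype.sum_prod_type, Fin.sum_univ_two] at h4
  simp [idTensor, swapTensor, diagTensor] at h4
  -- The coefficient κ is multiplied by 1 - (3/5)^4 - (4/5)^4 = 288/625.
  linear_combination (625 / 288 : ℂ) * h4

theorem integral_sum_column {ι : Type*} [Fintype ι] [DecidableEq ι] (b : Fin 4 → ι)
    (g : (Fin 4 → ι) → ℂ) :
    ∑ a, haarMoment a b * g a =
      ∫ U : Matrix.unitaryGroup ι ℂ, ∑ a, (∏ r, replicaHom r (U.1 (a r) (b r))) * g a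
        ∂haarUnitary ι := by
  rw [integral_finsetSum _ fun a _ =>
    (integrable_of_continuous _ (continuous_replicas a b)).mul_const _]
  simp_rw [integral_mul_const]
  rfl

theorem sum_tensor_products :
    (∑ a : Fin 4 → Fin 2 × Fin 2, (idTensor a : ℂ) * idTensor a = 16) ∧
    (∑ a : Fin 4 → Fin 2 × Fin 2, (swapTensor a : ℂ) * idTensor a = 4) ∧
    (∑ a : Fin 4 → Fin 2 × Fin 2, (idTensor a : ℂ) * swapTensor a = 4) ∧
    (∑ a : Fin 4 → Fin 2 × Fin 2, (swapTensor a : ℂ) * swapTensor a = 16) := by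
  have h : ∀ P Q : (Fin 4 → Fin 2 × Fin 2) → Prop, ∀ [DecidablePred P] [DecidablePred Q],
      ∑ a, (((if P a then (1 : ℝ) else 0 : ℝ) : ℂ) * ((if Q a then (1 : ℝ) else 0 : ℝ) : ℂ)) =
        ((Finset.univ.filter fun a => P a ∧ Q a).card : ℂ) := by
    intro P Q _ _
    rw [Finset.card_filter]
    push_cast
    refine Finset.sum_congr rfl fun a _ => ?_
    by_cases hP : P a <;> by_cases hQ : Q a <;> simp [hP, hQ]
  unfold idTensor swapTensor
  refine ⟨?_, ?_, ?_, ?_⟩ <;> rw [h] <;> norm_cast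

/-- Contracting with the identity and the swap, which column orthonormality evaluates pointwise in
U, gives a 2 × 2 system with Gram matrix (16, 4; 4, 16). Right invariance is not needed. -/
theorem haarMoment_eq (a b : Fin 4 → Fin 2 × Fin 2) :
    haarMoment a b = (4 * idTensor b - swapTensor b) / 60 * idTensor a +
      (4 * swapTensor b - idTensor b) / 60 * swapTensor a := by
  have h2 := fun a => haarMoment_eq_two_terms a b
  set q := haarMoment ![(0, 0), (1, 0), (0, 0), (1, 0)] b
  set r := haarMoment ![(0, 0), (1, 0), (1, 0), (0, 0)] b
  have hI := integral_sum_column b fun a => (idTensor a : ℂ)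
  have hS := integral_sum_column b fun a => (swapTensor a : ℂ)
  simp only [fun U : TwoQubitGate => sum_idTensor (A := fun x y => U.1 y x)
    (column_orthonormal U) b] at hI
  simp only [fun U : TwoQubitGate => sum_swapTensor (A := fun x y => U.1 y x)
    (column_orthonormal U) b] at hS
  simp only [h2, add_mul, Finset.sum_add_distrib, mul_assoc, ← Finset.mul_sum] at hI hS
  obtain ⟨t1, t2, t3, t4⟩ := sum_tensor_products
  rw [t1, t2, integral_const, probReal_univ, one_smul] at hI
  rw [t3, t4, integral_const, probReal_univ, one_smul] at hS
  rw [h2]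
  linear_combination ((4 * hI - hS) * idTensor a + (4 * hS - hI) * swapTensor a) / 60

/-! ### Two-copy observables -/

/-- The three one-qubit observables on two copies: the identity, the swap and the projection onto
equal computational basis states. -/
inductive Label
  | keep
  | swap
  | diag
  deriving DecidableEq

/-- The matrix elements of the observable of a label. -/
def Label.tensor : Label → (Fin 4 → Fin 2) → ℝ
  | .keep => idTensor
  | .swap => swapTensor
  | .diag => diagTensor

/-- The trace of the observable of a label. -/
def Label.trace : Label → ℝ
  | .keep => 4
  | .swap => 2
  | .diag => 2

/-- The trace of the observable of a label, composed with the swap. -/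
def Label.swapTrace : Label → ℝ
  | .keep => 2
  | .swap => 4
  | .diag => 2

/-- The coefficient of the identity in the Haar average of a product of two observables. -/
noncomputable def keepCoeff (l l' : Label) : ℝ :=
  (4 * (l.trace * l'.trace) - l.swapTrace * l'.swapTrace) / 60

/-- The coefficient of the swap in the Haar average of a product of two observables. -/
noncomputable def swapCoeff (l l' : Label) : ℝ :=
  (4 * (l.swapTrace * l'.swapTrace) - l.trace * l'.trace) / 60

theorem sum_tensor_idTensor (l : Label) :
    ∑ t : Fin 4 → Fin 2, l.tensor t * idTensor t = l.trace := by
  rw [sum_replicas]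
  cases l <;>
    simp [Label.tensor, Label.trace, idTensor, swapTensor, diagTensor, Fin.sum_univ_two] <;>
    norm_num

theorem sum_tensor_swapTensor (l : Label) :
    ∑ t : Fin 4 → Fin 2, l.tensor t * swapTensor t = l.swapTrace := by
  rw [sum_replicas]
  cases l <;>
    simp [Label.tensor, Label.swapTrace, idTensor, swapTensor, diagTensor, Fin.sum_univ_two] <;>
    norm_num

theorem idTensor_prod (a : Fin 4 → Fin 2 × Fin 2) :
    idTensor a = idTensor (fun r => (a r).1) * idTensor fun r => (a r).2 := by
  unfold idTensor
  simp only [Prod.ext_iff]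
  grind

theorem swapTensor_prod (a : Fin 4 → Fin 2 × Fin 2) :
    swapTensor a = swapTensor (fun r => (a r).1) * swapTensor fun r => (a r).2 := by
  unfold swapTensor
  simp only [Prod.ext_iff]
  grind

theorem sum_replicas_prod (f g : (Fin 4 → Fin 2) → ℝ) :
    ∑ a : Fin 4 → Fin 2 × Fin 2, f (fun r => (a r).1) * g (fun r => (a r).2) =
      (∑ t, f t) * ∑ t, g t := by
  rw [Finset.sum_mul_sum, ← Fintype.sum_prod_type',
    ← (Equiv.arrowProdEquivProdArrow (Fin 4) (fun _ => Fin 2) fun _ => Fin 2).sum_comp]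
  rfl

theorem sum_tensors_haarMoment (l l' : Label) (b : Fin 4 → Fin 2 × Fin 2) :
    ∑ a : Fin 4 → Fin 2 × Fin 2, haarMoment a b *
        ((l.tensor fun r => (a r).1) * (l'.tensor fun r => (a r).2) : ℝ) =
      ((keepCoeff l l' * idTensor b + swapCoeff l l' * swapTensor b : ℝ) : ℂ) := by
  have hI : ∑ a : Fin 4 → Fin 2 × Fin 2,
      idTensor a * ((l.tensor fun r => (a r).1) * (l'.tensor fun r => (a r).2)) =
      l.trace * l'.trace := by
    rw [← sum_tensor_idTensor, ← sum_tensor_idTensor, ← sum_replicas_prod]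
    refine Finset.sum_congr rfl fun a _ => ?_
    rw [idTensor_prod]; ring
  have hS : ∑ a : Fin 4 → Fin 2 × Fin 2,
      swapTensor a * ((l.tensor fun r => (a r).1) * (l'.tensor fun r => (a r).2)) =
      l.swapTrace * l'.swapTrace := by
    rw [← sum_tensor_swapTensor, ← sum_tensor_swapTensor, ← sum_replicas_prod]
    refine Finset.sum_congr rfl fun a _ => ?_
    rw [swapTensor_prod]; ring
  have : ∀ a, haarMoment a b = (((4 * idTensor b - swapTensor b) / 60 * idTensor a +
      (4 * swapTensor b - idTensor b) / 60 * swapTensor a : ℝ) : ℂ) := fun a => by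
    rw [haarMoment_eq]; push_cast; ring
  simp only [this, ← Complex.ofReal_mul, ← Complex.ofReal_sum]
  congr 1
  simp only [add_mul, Finset.sum_add_distrib, mul_assoc, ← Finset.mul_sum]
  rw [hI, hS, keepCoeff, swapCoeff]
  ring

/-- The expectation of the product observable with labels `σ` in two copies of the state `ψ`. -/
noncomputable def replicaSum {n : ℕ} (σ : Fin n → Label) (ψ : BitString n → ℂ) : ℂ :=
  ∑ z : Fin 4 → BitString n,
    ((∏ k, (σ k).tensor fun r => z r k : ℝ) : ℂ) * ∏ r, replicaHom r (ψ (z r))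

theorem prod_eq_mul_mul_prod_erase {α M : Type*} [Fintype α] [DecidableEq α] [CommMonoid M]
    {i j : α} (hij : i ≠ j) (f : α → M) :
    ∏ k, f k = f i * f j * ∏ k ∈ (Finset.univ.erase i).erase j, f k := by
  rw [mul_assoc, Finset.mul_prod_erase _ _ (by simp [hij.symm]),
    Finset.mul_prod_erase _ _ (Finset.mem_univ i)]

/-- The labels `σ` with both `i` and `j` relabelled to `l`. -/
def relabel {n : ℕ} (i j : Fin n) (l : Label) (σ : Fin n → Label) : Fin n → Label :=
  fun k => if k = i ∨ k = j then l else σ k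

theorem prod_relabel {n : ℕ} {M : Type*} [CommMonoid M] {i j : Fin n} (hij : i ≠ j) (l : Label)
    (σ : Fin n → Label) (f : Fin n → Label → M) :
    ∏ k, f k (relabel i j l σ k) =
      f i l * f j l * ∏ k ∈ (Finset.univ.erase i).erase j, f k (σ k) := by
  rw [prod_eq_mul_mul_prod_erase hij]
  congr 1
  · simp [relabel]
  · refine Finset.prod_congr rfl fun k hk => ?_
    simp only [Finset.mem_erase] at hk
    simp [relabel, hk.1, hk.2.1]

theorem sum_gateMatrix {n : ℕ} {i j : Fin n} (hij : i ≠ j) (σ : Fin n → Label)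
    (U : Matrix (Fin 2 × Fin 2) (Fin 2 × Fin 2) ℂ) (w : Fin 4 → BitString n) :
    ∑ z : Fin 4 → BitString n, ((∏ k, (σ k).tensor fun r => z r k : ℝ) : ℂ) *
        ∏ r, replicaHom r (gateMatrix i j U (z r) (w r)) =
      ∑ a : Fin 4 → Fin 2 × Fin 2, (∏ r, replicaHom r (U (a r) (w r i, w r j))) *
        (((σ i).tensor fun r => (a r).1) * ((σ j).tensor fun r => (a r).2) : ℝ) *
        ((∏ k ∈ (Finset.univ.erase i).erase j, (σ k).tensor fun r => w r k : ℝ) : ℂ) := by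
  set g : (Fin 4 → Fin 2 × Fin 2) → Fin 4 → BitString n :=
    fun a r => Function.update (Function.update (w r) i (a r).1) j (a r).2 with hg
  have gi : ∀ a r, g a r i = (a r).1 := fun a r => by simp [hg, hij]
  have gj : ∀ a r, g a r j = (a r).2 := fun a r => by simp [hg]
  have gk : ∀ a r k, k ≠ i → k ≠ j → g a r k = w r k := fun a r k h1 h2 => by simp [hg, h1, h2]
  have ginj : Function.Injective g := fun a b h => funext fun r =>
    Prod.ext (by rw [← gi a, h, gi]) (by rw [← gj a, h, gj])
  symm
  refine Fintype.sum_of_injective g ginj _ _ (fun z hz => ?_) (fun a => ?_)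
  · have : ∃ r, gateMatrix i j U (z r) (w r) = 0 := by
      by_contra hc
      push Not at hc
      obtain ⟨a, ha⟩ : ∃ a : Fin 4 → Fin 2 × Fin 2, a = fun r => (z r i, z r j) := ⟨_, rfl⟩
      refine hz ⟨a, funext fun r => funext fun k => ?_⟩
      by_cases hi : k = i
      · rw [hi, gi, ha]
      by_cases hj : k = j
      · rw [hj, gj, ha]
      rw [gk _ _ k hi hj]
      by_contra hne
      exact hc r (if_neg fun h => hne (h k hi hj).symm)
    obtain ⟨r, hr⟩ := this
    rw [Finset.prod_eq_zero (Finset.mem_univ r) (by rw [hr, map_zero]), mul_zero]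
  · have e1 : ∀ r, gateMatrix i j U (g a r) (w r) = U (a r) (w r i, w r j) := fun r => by
      rw [gateMatrix, if_pos fun k h1 h2 => gk a r k h1 h2, gi, gj]
    have e2 : ∏ k ∈ (Finset.univ.erase i).erase j, ((σ k).tensor fun r => g a r k) =
        ∏ k ∈ (Finset.univ.erase i).erase j, (σ k).tensor fun r => w r k := by
      refine Finset.prod_congr rfl fun k hk => ?_
      simp only [Finset.mem_erase] at hk
      congr 1
      exact funext fun r => gk a r k hk.2.1 hk.1
    rw [prod_eq_mul_mul_prod_erase hij, e2]
    simp only [e1, gi, gj]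
    push_cast
    ring

theorem replicaSum_mulVec {n : ℕ} (σ : Fin n → Label)
    (G : Matrix (BitString n) (BitString n) ℂ) (ψ : BitString n → ℂ) :
    replicaSum σ (G.mulVec ψ) =
      ∑ w : Fin 4 → BitString n, (∑ z : Fin 4 → BitString n,
        ((∏ k, (σ k).tensor fun r => z r k : ℝ) : ℂ) *
          ∏ r, replicaHom r (G (z r) (w r))) * ∏ r, replicaHom r (ψ (w r)) := by
  unfold replicaSum
  simp only [Matrix.mulVec, dotProduct]
  simp_rw [fun z : Fin 4 → BitString n => prod_replicaHom_mul G (fun _ => ψ) z, Finset.mul_sum,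
    Finset.sum_mul]
  rw [Finset.sum_comm]
  simp_rw [mul_assoc]

/-- One averaged gate on the qubits `i` and `j`, acting on functions of labels. -/
noncomputable def pairStep {n : ℕ} (i j : Fin n) (h : (Fin n → Label) → ℝ)
    (σ : Fin n → Label) : ℝ :=
  keepCoeff (σ i) (σ j) * h (relabel i j .keep σ) +
    swapCoeff (σ i) (σ j) * h (relabel i j .swap σ)

/-- The second-moment formula in the Heisenberg picture: the observables at `i` and `j` enter only
through their traces against identity and swap, and the other sites are untouched. -/
theorem integral_replicaSum_gate {n : ℕ} {i j : Fin n} (hij : i ≠ j) (σ : Fin n → Label)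
    (ψ : BitString n → ℂ) :
    ∫ U : TwoQubitGate, replicaSum σ ((gateMatrix i j U.1).mulVec ψ)
        ∂haarUnitary (Fin 2 × Fin 2) =
      keepCoeff (σ i) (σ j) * replicaSum (relabel i j .keep σ) ψ +
        swapCoeff (σ i) (σ j) * replicaSum (relabel i j .swap σ) ψ := by
  have hint : ∀ a b : Fin 4 → Fin 2 × Fin 2, Integrable
      (fun U : TwoQubitGate => ∏ r, replicaHom r (U.1 (a r) (b r)))
      (haarUnitary (Fin 2 × Fin 2)) := fun a b =>
    integrable_of_continuous _ (continuous_replicas a b)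
  simp only [replicaSum_mulVec, sum_gateMatrix hij]
  rw [integral_finsetSum _ fun w _ => (integrable_finsetSum _ fun a _ =>
    ((hint a _).mul_const _).mul_const _).mul_const _]
  simp_rw [integral_mul_const]
  have key : ∀ w : Fin 4 → BitString n,
      ∫ U : TwoQubitGate, ∑ a : Fin 4 → Fin 2 × Fin 2,
        (∏ r, replicaHom r (U.1 (a r) (w r i, w r j))) *
        (((σ i).tensor fun r => (a r).1) * ((σ j).tensor fun r => (a r).2) : ℝ) *
        ((∏ k ∈ (Finset.univ.erase i).erase j, (σ k).tensor fun r => w r k : ℝ) : ℂ)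
        ∂haarUnitary (Fin 2 × Fin 2) =
      keepCoeff (σ i) (σ j) *
          ((∏ k, (relabel i j .keep σ k).tensor fun r => w r k : ℝ) : ℂ) +
        swapCoeff (σ i) (σ j) *
          ((∏ k, (relabel i j .swap σ k).tensor fun r => w r k : ℝ) : ℂ) := by
    intro w
    rw [integral_finsetSum _ fun a _ => ((hint a _).mul_const _).mul_const _]
    simp_rw [integral_mul_const]
    rw [← Finset.sum_mul]
    have := sum_tensors_haarMoment (σ i) (σ j) fun r => (w r i, w r j)
    unfold haarMoment at this
    rw [this, prod_relabel hij .keep σ (fun k l => l.tensor fun r => w r k),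
      prod_relabel hij .swap σ (fun k l => l.tensor fun r => w r k), idTensor_prod,
      swapTensor_prod]
    simp only [Label.tensor]
    push_cast
    ring
  simp only [key, replicaSum, Finset.mul_sum, ← Finset.sum_add_distrib]
  refine Finset.sum_congr rfl fun w _ => by ring

/-! ### The recursion for expected observables -/

/-- The expected product observables of a random circuit of size `s`, as a function of the
labels. -/
noncomputable def labelValue (n : ℕ) : ℕ → (Fin n → Label) → ℝ
  | 0 => fun _ => 1
  | s + 1 => fun σ =>
    (Fintype.card (QubitPair n) : ℝ)⁻¹ *
      ∑ p : QubitPair n, pairStep p.1.1 p.1.2 (labelValue n s) σ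

theorem continuous_applyGate {n : ℕ} (p : QubitPair n) : Continuous (applyGate p) := by
  refine Continuous.subtype_mk (continuous_matrix fun x y => ?_) _
  unfold gateMatrix
  split_ifs
  · exact continuous_entry _ _
  · exact continuous_const

theorem continuous_replicaSum {n : ℕ} (σ : Fin n → Label) (y : BitString n) :
    Continuous fun C : QubitUnitary n => replicaSum σ fun x => C.1 x y :=
  continuous_finsetSum _ fun _ _ => continuous_const.mul <|
    continuous_finsetProd _ fun r _ => (continuous_replicaHom r).comp (continuous_entry _ _)

theorem card_qubitPair_pos {n : ℕ} (hn : 2 ≤ n) : 0 < Fintype.card (QubitPair n) :=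
  Fintype.card_pos_iff.2 ⟨⟨(⟨0, by omega⟩, ⟨1, by omega⟩), by simp [Fin.lt_def]⟩⟩

theorem isProbabilityMeasure_map_applyGate {n : ℕ} (p : QubitPair n) :
    IsProbabilityMeasure ((haarUnitary (Fin 2 × Fin 2)).map (applyGate p)) :=
  Measure.isProbabilityMeasure_map (continuous_applyGate p).measurable.aemeasurable

theorem isProbabilityMeasure_stepLaw {n : ℕ} (hn : 2 ≤ n) : IsProbabilityMeasure (stepLaw n) := by
  have := fun p : QubitPair n => isProbabilityMeasure_map_applyGate p
  refine ⟨?_⟩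
  simp only [stepLaw, Measure.smul_apply, Measure.finsetSum_apply, measure_univ,
    Finset.sum_const, Finset.card_univ, nsmul_eq_mul, mul_one, smul_eq_mul]
  exact ENNReal.inv_mul_cancel (by exact_mod_cast (card_qubitPair_pos hn).ne') (by simp)

theorem isProbabilityMeasure_circuitLaw {n : ℕ} (hn : 2 ≤ n) (s : ℕ) :
    IsProbabilityMeasure (circuitLaw n s) := by
  have := isProbabilityMeasure_stepLaw hn
  induction s with
  | zero => unfold circuitLaw; infer_instance
  | succ s ih => unfold circuitLaw; infer_instance

theorem integral_stepLaw {n : ℕ} {f : QubitUnitary n → ℂ} (hf : Continuous f) :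
    ∫ G, f G ∂stepLaw n = (Fintype.card (QubitPair n) : ℂ)⁻¹ *
      ∑ p : QubitPair n, ∫ U, f (applyGate p U) ∂haarUnitary (Fin 2 × Fin 2) := by
  have := fun p : QubitPair n => isProbabilityMeasure_map_applyGate p
  rw [stepLaw, integral_smul_measure, integral_finsetSum_measure fun p _ =>
    integrable_of_continuous _ hf]
  simp only [ENNReal.toReal_inv, ENNReal.toReal_natCast, Complex.real_smul]
  push_cast
  congr 1
  refine Finset.sum_congr rfl fun p _ => ?_
  exact integral_map (continuous_applyGate p).measurable.aemeasurable
    hf.aestronglyMeasurable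

theorem integral_replicaSum {n : ℕ} (hn : 2 ≤ n) (s : ℕ) (σ : Fin n → Label) :
    ∫ C, replicaSum σ (fun x => C.1 x 0) ∂circuitLaw n s = labelValue n s σ := by
  have hstep := isProbabilityMeasure_stepLaw hn
  have hcirc := isProbabilityMeasure_circuitLaw hn
  induction s generalizing σ with
  | zero =>
    rw [circuitLaw, integral_dirac, replicaSum, Finset.sum_eq_single 0]
    · have : ∀ l : Label, l.tensor (fun _ => 0) = 1 := fun l => by
        cases l <;> simp [Label.tensor, idTensor, swapTensor, diagTensor]
      simp [labelValue, this]
    · intro z _ hz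
      obtain ⟨r, hr⟩ := Function.ne_iff.1 hz
      rw [Finset.prod_eq_zero (Finset.mem_univ r), mul_zero]
      rw [Submonoid.coe_one, Matrix.one_apply_ne (by simpa using hr), map_zero]
    · simp
  | succ s ih =>
    have hcont := continuous_replicaSum σ (0 : BitString n)
    have := hcirc (s + 1)
    rw [circuitLaw] at this ⊢
    rw [integral_mconv (integrable_of_continuous _ hcont)]
    have h1 : ∀ C : QubitUnitary n,
        ∫ G : QubitUnitary n, replicaSum σ (fun x => (G * C).1 x 0) ∂stepLaw n =
        (Fintype.card (QubitPair n) : ℂ)⁻¹ * ∑ p : QubitPair n,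
          (keepCoeff (σ p.1.1) (σ p.1.2) *
              replicaSum (relabel p.1.1 p.1.2 .keep σ) (fun x => C.1 x 0) +
            swapCoeff (σ p.1.1) (σ p.1.2) *
              replicaSum (relabel p.1.1 p.1.2 .swap σ) (fun x => C.1 x 0)) := by
      intro C
      have hC : Continuous fun G : QubitUnitary n => replicaSum σ fun x => (G * C).1 x 0 :=
        hcont.comp (continuous_mul_const C)
      rw [integral_stepLaw hC]
      congr 1
      refine Finset.sum_congr rfl fun p _ => ?_
      rw [← integral_replicaSum_gate (ne_of_lt p.2)]
      rfl
    -- The convolution integrates the last gate G outermost; the recursion needs it averaged first,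
    -- with C fixed.
    have hswap : ∫ G : QubitUnitary n, ∫ C : QubitUnitary n,
        replicaSum σ (fun x => (G * C).1 x 0) ∂circuitLaw n s ∂stepLaw n =
        ∫ C : QubitUnitary n, ∫ G : QubitUnitary n,
        replicaSum σ (fun x => (G * C).1 x 0) ∂stepLaw n ∂circuitLaw n s := by
      refine integral_integral_swap ?_
      have : Continuous (Function.uncurry fun G C : QubitUnitary n =>
          replicaSum σ (fun x => (G * C).1 x 0)) := hcont.comp continuous_mul
      exact this.integrable_of_hasCompactSupport (HasCompactSupport.of_compactSpace _)
    rw [hswap]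
    have hi : ∀ σ' : Fin n → Label, Integrable
        (fun C : QubitUnitary n => replicaSum σ' (fun x => C.1 x 0)) (circuitLaw n s) := fun σ' =>
      integrable_of_continuous _ (continuous_replicaSum σ' 0)
    have hadd : ∀ p : QubitPair n, Integrable (fun C : QubitUnitary n =>
        (keepCoeff (σ p.1.1) (σ p.1.2) : ℂ) *
            replicaSum (relabel p.1.1 p.1.2 .keep σ) (fun x => C.1 x 0) +
          (swapCoeff (σ p.1.1) (σ p.1.2) : ℂ) *
            replicaSum (relabel p.1.1 p.1.2 .swap σ) (fun x => C.1 x 0)) (circuitLaw n s) :=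
      fun p => ((hi _).const_mul _).add ((hi _).const_mul _)
    simp only [h1]
    rw [integral_const_mul, integral_finsetSum _ fun p _ => hadd p]
    simp_rw [fun p : QubitPair n => integral_add
      ((hi (relabel p.1.1 p.1.2 .keep σ)).const_mul (keepCoeff (σ p.1.1) (σ p.1.2) : ℂ))
      ((hi (relabel p.1.1 p.1.2 .swap σ)).const_mul (swapCoeff (σ p.1.1) (σ p.1.2) : ℂ)),
      integral_const_mul, ih]
    simp only [labelValue, pairStep]
    push_cast
    rfl

/-- Bit strings agree exactly when they agree at every qubit, so the product of one-qubit
projections is the projection for whole strings. -/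
theorem replicaSum_diag {n : ℕ} (ψ : BitString n → ℂ) :
    replicaSum (fun _ => .diag) ψ = ((∑ x, ‖ψ x‖ ^ 4 : ℝ) : ℂ) := by
  have h : ∀ z : Fin 4 → BitString n,
      ∏ k, Label.diag.tensor (fun r => z r k) = diagTensor z := by
    intro z
    by_cases hz : z 0 = z 1 ∧ z 1 = z 2 ∧ z 2 = z 3
    · simp [Label.tensor, diagTensor, hz]
    · have : ∃ k, ¬(z 0 k = z 1 k ∧ z 1 k = z 2 k ∧ z 2 k = z 3 k) := by
        by_contra hc
        push Not at hc
        exact hz ⟨funext fun k => (hc k).1, funext fun k => (hc k).2.1,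
          funext fun k => (hc k).2.2⟩
      obtain ⟨k, hk⟩ := this
      rw [Finset.prod_eq_zero (Finset.mem_univ k)]
      · rw [diagTensor, if_neg hz]
      · rw [Label.tensor, diagTensor, if_neg hk]
  simp only [replicaSum, h]
  simp_rw [mul_comm ((diagTensor _ : ℝ) : ℂ)]
  rw [sum_diagTensor, Complex.ofReal_sum]
  refine Finset.sum_congr rfl fun x _ => ?_
  rw [prod_replicaHom]
  have := Complex.mul_conj (ψ x)
  rw [Complex.normSq_eq_norm_sq] at this
  rw [← starRingEnd_apply]
  push_cast at this ⊢
  linear_combination (ψ x * (starRingEnd ℂ) (ψ x) + (‖ψ x‖ : ℂ) ^ 2) * this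

theorem expectedColl_eq {n : ℕ} (hn : 2 ≤ n) (s : ℕ) :
    expectedColl n s = labelValue n s fun _ => .diag := by
  rw [← Complex.ofReal_inj, ← integral_replicaSum hn, expectedColl, ← integral_complex_ofReal]
  simp only [replicaSum_diag]
  rfl

/-! ### Sums over pairs of qubits -/

theorem two_mul_sum_qubitPair {n : ℕ} (F : Fin n → Fin n → ℝ) (hF : ∀ i j, F i j = F j i) :
    2 * ∑ p : QubitPair n, F p.1.1 p.1.2 = ∑ i, ∑ j, F i j - ∑ i, F i i := by
  have h1 : ∑ p : QubitPair n, F p.1.1 p.1.2 = ∑ i, ∑ j, if i < j then F i j else 0 := by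
    rw [← Fintype.sum_prod_type', ← Finset.sum_filter]
    exact (Finset.sum_subtype _ (fun p => by simp) (fun p : Fin n × Fin n => F p.1 p.2)).symm
  have h2 : ∑ p : QubitPair n, F p.1.1 p.1.2 = ∑ i, ∑ j, if j < i then F i j else 0 := by
    rw [h1, Finset.sum_comm]
    simp_rw [hF]
  have h3 : ∑ i, F i i = ∑ i, ∑ j, if i = j then F i j else 0 := by simp
  rw [two_mul, eq_sub_iff_add_eq]
  nth_rw 1 [h1]
  rw [h2, h3]
  simp only [← Finset.sum_add_distrib]
  refine Finset.sum_congr rfl fun i _ => Finset.sum_congr rfl fun j _ => ?_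
  rcases lt_trichotomy i j with h | h | h
  · simp [h, h.ne, h.not_gt]
  · simp [h]
  · simp [h, h.ne', h.not_gt]

theorem two_mul_card_qubitPair (n : ℕ) :
    2 * (Fintype.card (QubitPair n) : ℝ) = n * (n - 1) := by
  have := two_mul_sum_qubitPair (n := n) (fun _ _ => 1) fun _ _ => rfl
  simp only [Finset.sum_const, Finset.card_univ, nsmul_eq_mul, mul_one, Fintype.card_fin] at this
  rw [this]; ring

theorem sum_qubitPair_add {n : ℕ} (f : Fin n → ℝ) :
    ∑ p : QubitPair n, (f p.1.1 + f p.1.2) = (n - 1) * ∑ i, f i := by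
  have := two_mul_sum_qubitPair (n := n) (fun i j => f i + f j) fun i j => add_comm _ _
  simp only [Finset.sum_add_distrib, Finset.sum_const, Finset.card_univ, nsmul_eq_mul,
    Fintype.card_fin, ← Finset.mul_sum] at this
  simp only [Finset.sum_add_distrib]
  linarith

/-- The number of sites with a given label. -/
def count {n : ℕ} (l : Label) (σ : Fin n → Label) : ℕ := (Finset.univ.filter fun k => σ k = l).card

theorem sum_ite_eq_count {n : ℕ} (l : Label) (σ : Fin n → Label) :
    ∑ k, (if σ k = l then (1 : ℝ) else 0) = count l σ := by
  rw [count, Finset.card_filter]; push_cast; rfl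

theorem count_add {n : ℕ} (σ : Fin n → Label) :
    count .keep σ + count .swap σ + count .diag σ = n := by
  simp only [count, Finset.card_filter, ← Finset.sum_add_distrib]
  rw [Finset.sum_congr rfl (g := fun _ => 1)]
  · simp
  · intro k _
    cases σ k <;> simp

theorem eq_const_of_count {n : ℕ} {l : Label} {σ : Fin n → Label} (h : count l σ = n) :
    σ = fun _ => l := by
  have : (Finset.univ.filter fun k => σ k = l) = Finset.univ := by
    rw [← Finset.card_eq_iff_eq_univ, Fintype.card_fin]; exact h
  ext k
  simpa using (Finset.ext_iff.1 this k).2 (Finset.mem_univ k)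

/-- Each pair with exactly one site labelled `l` has unequal labels. -/
theorem count_mul_le_sum_ne {n : ℕ} (l : Label) (σ : Fin n → Label) :
    (count l σ : ℝ) * (n - count l σ) ≤
      ∑ p : QubitPair n, if σ p.1.1 ≠ σ p.1.2 then (1 : ℝ) else 0 := by
  have h := two_mul_sum_qubitPair (fun i j => if σ i ≠ σ j then (1 : ℝ) else 0)
    fun i j => by simp [eq_comm]
  have h' : 2 * ((count l σ : ℝ) * (n - count l σ)) ≤
      ∑ i, ∑ j, if σ i ≠ σ j then (1 : ℝ) else 0 := by
    set f : Fin n → ℝ := fun k => if σ k = l then 1 else 0 with hf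
    have hsum : ∑ k, f k = count l σ := sum_ite_eq_count l σ
    calc 2 * ((count l σ : ℝ) * (n - count l σ))
        = ∑ i, ∑ j, (f i * (1 - f j) + (1 - f i) * f j) := by
          simp only [Finset.sum_add_distrib, ← Finset.mul_sum, ← Finset.sum_mul,
            Finset.sum_sub_distrib, hsum, Finset.sum_const, Finset.card_univ, Fintype.card_fin,
            nsmul_eq_mul, mul_one]
          ring
      _ ≤ _ := by
          refine Finset.sum_le_sum fun i _ => Finset.sum_le_sum fun j _ => ?_
          simp only [hf]
          by_cases hi : σ i = l <;> by_cases hj : σ j = l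
          · simp [hi, hj]
          · simp [hi, hj, Ne.symm hj]
          · simp [hi, hj]
          · simp only [hi, hj, if_false]; split_ifs <;> norm_num
  simp only [ne_eq, not_true_eq_false, if_false, Finset.sum_const_zero, sub_zero] at h
  simp only [ne_eq] at h' ⊢
  linarith

/-! ### Product weights -/

/-- The factor of a site in a product weight. -/
def siteWeight (x y b : ℝ) : Label → ℝ
  | .keep => x
  | .swap => y
  | .diag => b

/-- The product weight with factors `x`, `y`, `b` for the three labels. -/
noncomputable def weight {n : ℕ} (x y b : ℝ) (σ : Fin n → Label) : ℝ :=
  ∏ k, siteWeight x y b (σ k)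

theorem weight_eq {n : ℕ} (x y b : ℝ) (σ : Fin n → Label) :
    weight x y b σ = x ^ count .keep σ * y ^ count .swap σ * b ^ count .diag σ := by
  have : ∀ l : Label, siteWeight x y b l = x ^ (if l = .keep then 1 else 0) *
      y ^ (if l = .swap then 1 else 0) * b ^ (if l = .diag then 1 else 0) := fun l => by
    cases l <;> simp [siteWeight]
  simp only [weight, this, Finset.prod_mul_distrib, Finset.prod_pow_eq_pow_sum, count,
    Finset.card_filter]

theorem weight_nonneg {n : ℕ} {x y b : ℝ} (hx : 0 ≤ x) (hy : 0 ≤ y) (hb : 0 ≤ b)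
    (σ : Fin n → Label) : 0 ≤ weight x y b σ := by
  rw [weight_eq]; positivity

theorem keepCoeff_nonneg (l l' : Label) : 0 ≤ keepCoeff l l' := by
  cases l <;> cases l' <;> norm_num [keepCoeff, Label.trace, Label.swapTrace]

theorem swapCoeff_nonneg (l l' : Label) : 0 ≤ swapCoeff l l' := by
  cases l <;> cases l' <;> norm_num [swapCoeff, Label.trace, Label.swapTrace]

theorem pairStep_mono {n : ℕ} (i j : Fin n) {g h : (Fin n → Label) → ℝ} (hgh : ∀ σ, g σ ≤ h σ)
    (σ : Fin n → Label) : pairStep i j g σ ≤ pairStep i j h σ :=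
  add_le_add (mul_le_mul_of_nonneg_left (hgh _) (keepCoeff_nonneg _ _))
    (mul_le_mul_of_nonneg_left (hgh _) (swapCoeff_nonneg _ _))

/-- The factor of a pair of sites in a product weight after an averaged gate. -/
noncomputable def pairWeight (x y : ℝ) (l l' : Label) : ℝ :=
  keepCoeff l l' * x ^ 2 + swapCoeff l l' * y ^ 2

theorem pairStep_weight {n : ℕ} {i j : Fin n} (hij : i ≠ j) (x y b : ℝ) (σ : Fin n → Label) :
    pairStep i j (weight x y b) σ = pairWeight x y (σ i) (σ j) *
      ∏ k ∈ (Finset.univ.erase i).erase j, siteWeight x y b (σ k) := by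
  simp only [pairStep, weight]
  rw [prod_relabel hij .keep σ fun _ l => siteWeight x y b l,
    prod_relabel hij .swap σ fun _ l => siteWeight x y b l]
  simp only [siteWeight, pairWeight]
  ring

theorem pairStep_weight_le {n : ℕ} {i j : Fin n} (hij : i ≠ j) {x y b κ : ℝ} (hx : 0 ≤ x)
    (hy : 0 ≤ y) (hb : 0 ≤ b) (σ : Fin n → Label)
    (h : pairWeight x y (σ i) (σ j) ≤ κ * (siteWeight x y b (σ i) * siteWeight x y b (σ j))) :
    pairStep i j (weight x y b) σ ≤ κ * weight x y b σ := by
  rw [pairStep_weight hij, weight, prod_eq_mul_mul_prod_erase hij, ← mul_assoc]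
  refine mul_le_mul_of_nonneg_right h (Finset.prod_nonneg fun k _ => ?_)
  cases σ k <;> assumption

theorem pairStep_weight_eq {n : ℕ} {i j : Fin n} (hij : i ≠ j) {x y b κ : ℝ}
    (σ : Fin n → Label)
    (h : pairWeight x y (σ i) (σ j) = κ * (siteWeight x y b (σ i) * siteWeight x y b (σ j))) :
    pairStep i j (weight x y b) σ = κ * weight x y b σ := by
  rw [pairStep_weight hij, weight, prod_eq_mul_mul_prod_erase hij, ← mul_assoc, h]

/-- The sum of the product weights of the two branches near all-identity and all-swap labels. -/
noncomputable def branchWeight {n : ℕ} (a b : ℝ) (σ : Fin n → Label) : ℝ :=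
  weight 1 a b σ + weight a 1 b σ

theorem branchWeight_eq {n : ℕ} (a b : ℝ) (σ : Fin n → Label) :
    branchWeight a b σ = (a ^ count .swap σ + a ^ count .keep σ) * b ^ count .diag σ := by
  rw [branchWeight, weight_eq, weight_eq]; ring

theorem pairStep_branchWeight_le {n : ℕ} {i j : Fin n} (hij : i ≠ j) {a b κ : ℝ} (ha : 0 ≤ a)
    (hb : 0 ≤ b) (σ : Fin n → Label)
    (h : pairWeight 1 a (σ i) (σ j) ≤ κ * (siteWeight 1 a b (σ i) * siteWeight 1 a b (σ j)))
    (h' : pairWeight a 1 (σ i) (σ j) ≤ κ * (siteWeight a 1 b (σ i) * siteWeight a 1 b (σ j))) :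
    pairStep i j (branchWeight a b) σ ≤ κ * branchWeight a b σ := by
  have h1 := pairStep_weight_le hij zero_le_one ha hb σ h
  have h2 := pairStep_weight_le hij ha zero_le_one hb σ h'
  have : pairStep i j (branchWeight a b) σ =
      pairStep i j (weight 1 a b) σ + pairStep i j (weight a 1 b) σ := by
    simp only [pairStep, branchWeight]; ring
  rw [this, branchWeight, mul_add]
  exact add_le_add h1 h2

theorem labelValue_succ_le {n : ℕ} (s : ℕ) {g : (Fin n → Label) → ℝ}
    (hg : ∀ σ, labelValue n s σ ≤ g σ) {σ : Fin n → Label} {κ : QubitPair n → ℝ}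
    (hκ : ∀ p, pairStep p.1.1 p.1.2 g σ ≤ κ p * g σ) :
    labelValue n (s + 1) σ ≤ (Fintype.card (QubitPair n) : ℝ)⁻¹ * (∑ p, κ p) * g σ := by
  rw [labelValue, mul_assoc, Finset.sum_mul]
  refine mul_le_mul_of_nonneg_left (Finset.sum_le_sum fun p _ => ?_) (by positivity)
  exact (pairStep_mono _ _ hg σ).trans (hκ p)

theorem le_labelValue_succ {n : ℕ} (s : ℕ) {g : (Fin n → Label) → ℝ}
    (hg : ∀ σ, g σ ≤ labelValue n s σ) {σ : Fin n → Label} {κ : QubitPair n → ℝ}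
    (hκ : ∀ p, κ p * g σ ≤ pairStep p.1.1 p.1.2 g σ) :
    (Fintype.card (QubitPair n) : ℝ)⁻¹ * (∑ p, κ p) * g σ ≤ labelValue n (s + 1) σ := by
  rw [labelValue, mul_assoc, Finset.sum_mul]
  refine mul_le_mul_of_nonneg_left (Finset.sum_le_sum fun p _ => ?_) (by positivity)
  exact (hκ p).trans (pairStep_mono _ _ hg σ)

/-- The indicator of the label `diag`. -/
def isDiag : Label → ℝ
  | .keep => 0
  | .swap => 0
  | .diag => 1

theorem mean_isDiag {n : ℕ} (hn : 2 ≤ n) (σ : Fin n → Label) :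
    (Fintype.card (QubitPair n) : ℝ)⁻¹ *
      ∑ p : QubitPair n, (isDiag (σ p.1.1) + isDiag (σ p.1.2)) = 2 * count .diag σ / n := by
  have h1 := sum_qubitPair_add fun k => isDiag (σ k)
  have h2 : ∑ k, isDiag (σ k) = count .diag σ := by
    rw [← sum_ite_eq_count]
    refine Finset.sum_congr rfl fun k _ => ?_
    cases σ k <;> simp [isDiag]
  have h3 := two_mul_card_qubitPair n
  have hn' : (2 : ℝ) ≤ n := by exact_mod_cast hn
  have hc : (Fintype.card (QubitPair n) : ℝ) = n * (n - 1) / 2 := by linarith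
  have h4 : (n : ℝ) - 1 ≠ 0 := by linarith
  rw [h1, h2, hc]
  field_simp

/-! ### The lower bound -/

/-- For L = 0 the factors 1, 1/2, 1/2 are `Label.trace` divided by 4, that is, expectations in the
maximally mixed state, which gates preserve. Raising the `diag` factor by e^L only divides by e^L
per `diag` site, since a gate leaves none on its pair. -/
theorem pairWeight_half (L : ℝ) (l l' : Label) :
    pairWeight 1 (1 / 2) l l' = Real.exp (-(L * (isDiag l + isDiag l'))) *
      (siteWeight 1 (1 / 2) (Real.exp L / 2) l * siteWeight 1 (1 / 2) (Real.exp L / 2) l') := by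
  have h1 : Real.exp (-L) * Real.exp L = 1 := by rw [← Real.exp_add]; simp
  have h2 : Real.exp (-(L * 2)) * (Real.exp L * Real.exp L) = 1 := by
    rw [← Real.exp_add, ← Real.exp_add, ← Real.exp_zero]; congr 1; ring
  cases l <;> cases l' <;>
    simp only [pairWeight, keepCoeff, swapCoeff, Label.trace, Label.swapTrace, siteWeight,
      isDiag, add_zero, zero_add, mul_zero, neg_zero, Real.exp_zero, mul_one, one_add_one_eq_two] <;>
    linarith

theorem weight_le_labelValue {n : ℕ} (hn : 2 ≤ n) (s : ℕ) (σ : Fin n → Label) :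
    weight 1 (1 / 2) (Real.exp (Real.log 2 * (1 - 2 / n) ^ s) / 2) σ ≤ labelValue n s σ := by
  induction s generalizing σ with
  | zero =>
    rw [labelValue, weight_eq, pow_zero, mul_one, Real.exp_log two_pos, div_self two_ne_zero,
      one_pow, one_pow, one_mul, mul_one]
    exact pow_le_one₀ (by norm_num) (by norm_num)
  | succ s ih =>
    set L := Real.log 2 * (1 - 2 / n) ^ s with hL
    have hcard : (0 : ℝ) < Fintype.card (QubitPair n) := by exact_mod_cast card_qubitPair_pos hn
    have h := le_labelValue_succ s ih (σ := σ)
      (κ := fun p => Real.exp (-(L * (isDiag (σ p.1.1) + isDiag (σ p.1.2))))) fun p =>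
      (pairStep_weight_eq (ne_of_lt p.2) σ (pairWeight_half L _ _)).ge
    refine le_trans ?_ h
    set τ : ℝ := 2 * count .diag σ / n with hτ
    have hmean := mean_isDiag hn σ
    -- Jensen's inequality, proved through the tangent line of the exponential at the mean τ.
    have hJ : Real.exp (-(L * τ)) ≤ (Fintype.card (QubitPair n) : ℝ)⁻¹ *
        ∑ p : QubitPair n, Real.exp (-(L * (isDiag (σ p.1.1) + isDiag (σ p.1.2)))) := by
      calc Real.exp (-(L * τ)) = (Fintype.card (QubitPair n) : ℝ)⁻¹ * ∑ p : QubitPair n,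
            Real.exp (-(L * τ)) * (1 + L * τ - L * (isDiag (σ p.1.1) + isDiag (σ p.1.2))) := by
            rw [← Finset.mul_sum, Finset.sum_sub_distrib, ← Finset.mul_sum, Finset.sum_const,
              Finset.card_univ, nsmul_eq_mul]
            rw [inv_mul_eq_iff_eq_mul₀ hcard.ne'] at hmean
            rw [hmean, ← hτ]
            field_simp
            ring
        _ ≤ _ := by
            refine mul_le_mul_of_nonneg_left (Finset.sum_le_sum fun p _ => ?_) (by positivity)
            have := Real.add_one_le_exp (L * τ - L * (isDiag (σ p.1.1) + isDiag (σ p.1.2)))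
            calc _ ≤ Real.exp (-(L * τ)) *
                  Real.exp (L * τ - L * (isDiag (σ p.1.1) + isDiag (σ p.1.2))) :=
                  mul_le_mul_of_nonneg_left (by linarith) (Real.exp_pos _).le
              _ = _ := by rw [← Real.exp_add]; congr 1; ring
    have hw := weight_nonneg (x := 1) (y := 1 / 2) (b := Real.exp L / 2) (by norm_num)
      (by norm_num) (by positivity) σ
    refine le_trans (le_of_eq ?_) (mul_le_mul_of_nonneg_right hJ hw)
    have e : Real.log 2 * (1 - 2 / n) ^ (s + 1) = -(L * (2 / n)) + L := by
      rw [hL, pow_succ]; ring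
    have e2 : Real.exp (-(L * τ)) = Real.exp (-(L * (2 / n))) ^ count .diag σ := by
      rw [← Real.exp_nat_mul, hτ]; congr 1; ring
    rw [e, weight_eq, weight_eq, e2, Real.exp_add, mul_div_assoc, mul_pow]
    ring

theorem two_rpow_le_labelValue {n : ℕ} (hn : 2 ≤ n) (s : ℕ) :
    (2 : ℝ) ^ ((n : ℝ) * (1 - 2 / n) ^ s) / 2 ^ n ≤ labelValue n s fun _ => .diag := by
  have h := weight_le_labelValue hn s fun _ => .diag
  have c : ∀ l : Label, l ≠ .diag → count l (fun _ : Fin n => Label.diag) = 0 := fun l hl => by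
    simp [count, hl.symm]
  have c' : count .diag (fun _ : Fin n => Label.diag) = n := by simp [count]
  rw [weight_eq, c .keep (by decide), c .swap (by decide), c', div_pow _ _ n, ← Real.exp_nat_mul] at h
  rw [Real.rpow_def_of_pos two_pos]
  convert h using 1
  simp only [pow_zero, one_mul]
  congr 2
  ring

/-! ### The upper bound -/

theorem labelValue_const {n : ℕ} (hn : 2 ≤ n) (s : ℕ) {l : Label} (hl : l ≠ .diag) :
    labelValue n s (fun _ => l) = 1 := by
  have hcard : (0 : ℝ) < Fintype.card (QubitPair n) := by exact_mod_cast card_qubitPair_pos hn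
  induction s with
  | zero => rfl
  | succ s ih =>
    have h : ∀ i j : Fin n, relabel i j l (fun _ => l) = fun _ => l := fun i j => by
      ext k; simp [relabel]
    have : ∀ p : QubitPair n, pairStep p.1.1 p.1.2 (labelValue n s) (fun _ => l) = 1 := by
      intro p
      cases l
      · simp only [pairStep, h, ih]
        norm_num [keepCoeff, swapCoeff, Label.trace, Label.swapTrace]
      · simp only [pairStep, h, ih]
        norm_num [keepCoeff, swapCoeff, Label.trace, Label.swapTrace]
      · exact absurd rfl hl
    simp only [labelValue, this, Finset.sum_const, Finset.card_univ, nsmul_eq_mul, mul_one]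
    exact inv_mul_cancel₀ hcard.ne'

/-! ### Inequalities between label counts and powers -/

theorem mul_mul_one_sub_pow_le_one {θ : ℝ} (h0 : 0 ≤ θ) (h1 : θ ≤ 1) (m : ℕ) :
    θ * (m * (1 - θ) ^ m) ≤ 1 := by
  have hb : 1 + (m : ℝ) * θ ≤ (1 + θ) ^ m := one_add_mul_le_pow (by linarith) m
  have hp : 0 ≤ (1 - θ) ^ m := pow_nonneg (by linarith) m
  have : (1 + θ) ^ m * (1 - θ) ^ m ≤ 1 := by
    rw [← mul_pow]
    exact pow_le_one₀ (mul_nonneg (by linarith) (by linarith)) (by nlinarith)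
  nlinarith [mul_le_mul_of_nonneg_right hb hp]

/-- The left side is what lowering a costs; the right side counts unequal pairs. If l ≤ n/2 then n ≤
2(n - l) suffices. Otherwise put r = n - l, so k ≤ r and l = m + r: the dangerous part m a^m a^r,
where unequal pairs are scarce, is absorbed by a^k ≥ a^r because (1 - a) m a^m ≤ 1. This is where
both branches and the factor 1 - a are needed. -/
theorem count_pow_le_of_le {a : ℝ} (h0 : 0 ≤ a) (h1 : a ≤ 1) {n k l : ℕ} (hkl : k ≤ l)
    (hln : l < n) (h : k + l ≤ n) :
    (1 - a) * (n * (k * a ^ k + l * a ^ l)) ≤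
      4 * ((l : ℝ) * (n - l)) * (a ^ k + a ^ l) := by
  have hk : 0 ≤ a ^ k := pow_nonneg h0 k
  have hl : 0 ≤ a ^ l := pow_nonneg h0 l
  have c1 : (k : ℝ) ≤ l := by exact_mod_cast hkl
  have c2 : (l : ℝ) + 1 ≤ n := by exact_mod_cast hln
  have c3 : (k : ℝ) + l ≤ n := by exact_mod_cast h
  have ck : (0 : ℝ) ≤ k := k.cast_nonneg
  have cl : (0 : ℝ) ≤ l := l.cast_nonneg
  by_cases h2 : 2 * l ≤ n
  · have c4 : 2 * (l : ℝ) ≤ n := by exact_mod_cast h2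
    calc (1 - a) * (n * (k * a ^ k + l * a ^ l)) ≤ 1 * (n * (k * a ^ k + l * a ^ l)) :=
          mul_le_mul_of_nonneg_right (by linarith) (by positivity)
      _ ≤ 1 * ((2 * (n - l)) * (l * a ^ k + l * a ^ l)) := by
          rw [one_mul, one_mul]
          refine mul_le_mul (by linarith) ?_ (by positivity) (by linarith)
          linarith [mul_le_mul_of_nonneg_right c1 hk]
      _ ≤ _ := by
          have : 0 ≤ (l : ℝ) * (n - l) * (a ^ k + a ^ l) :=
            mul_nonneg (mul_nonneg cl (by linarith)) (by positivity)
          linarith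
  · push Not at h2
    obtain ⟨r, hr⟩ : ∃ r, n = l + r := ⟨n - l, by omega⟩
    obtain ⟨m, hm⟩ : ∃ m, l = m + r := ⟨l - r, by omega⟩
    have cr : (n : ℝ) - l = r := by rw [hr]; push_cast; ring
    have hkr : k ≤ r := by omega
    have c5 : (k : ℝ) ≤ r := by exact_mod_cast hkr
    have c6 : (1 : ℝ) ≤ r := by linarith
    have c7 : (n : ℝ) ≤ 2 * l := by exact_mod_cast h2.le
    have hm1 := mul_mul_one_sub_pow_le_one (θ := 1 - a) (by linarith) (by linarith) m
    rw [sub_sub_cancel] at hm1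
    have hrk : a ^ r ≤ a ^ k := pow_le_pow_of_le_one h0 h1 hkr
    have hr0 : 0 ≤ a ^ r := pow_nonneg h0 r
    have e1 : (1 - a) * (k * a ^ k) ≤ r * a ^ k := by
      calc (1 - a) * (k * a ^ k) ≤ 1 * (k * a ^ k) :=
            mul_le_mul_of_nonneg_right (by linarith) (by positivity)
        _ ≤ r * a ^ k := by rw [one_mul]; exact mul_le_mul_of_nonneg_right c5 hk
    have e2 : (1 - a) * (l * a ^ l) ≤ r * a ^ l + a ^ k := by
      have : (1 - a) * (l * a ^ l) =
          (1 - a) * (r * a ^ l) + (1 - a) * (m * a ^ m) * a ^ r := by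
        rw [hm, pow_add]; push_cast; ring
      rw [this]
      have f1 : (1 - a) * (r * a ^ l) ≤ 1 * (r * a ^ l) :=
        mul_le_mul_of_nonneg_right (by linarith) (by positivity)
      have f2 := mul_le_mul_of_nonneg_right hm1 hr0
      linarith
    have e3 : (1 - a) * (k * a ^ k + l * a ^ l) ≤ 2 * r * (a ^ k + a ^ l) := by
      have f1 := mul_le_mul_of_nonneg_right c6 hk
      have f2 : 0 ≤ r * a ^ l := by positivity
      nlinarith
    rw [cr]
    calc (1 - a) * (n * (k * a ^ k + l * a ^ l))
        = n * ((1 - a) * (k * a ^ k + l * a ^ l)) := by ring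
      _ ≤ (2 * l) * (2 * r * (a ^ k + a ^ l)) :=
          mul_le_mul c7 e3 (mul_nonneg (by linarith) (by positivity)) (by positivity)
      _ = _ := by ring

theorem count_pow_le {a D : ℝ} (h0 : 0 ≤ a) (h1 : a ≤ 1) {n k l : ℕ} (hkn : k < n)
    (hln : l < n) (h : k + l ≤ n) (hk : (k : ℝ) * (n - k) ≤ D) (hl : (l : ℝ) * (n - l) ≤ D) :
    (1 - a) * (n * (k * a ^ k + l * a ^ l)) ≤ 4 * D * (a ^ k + a ^ l) := by
  have hp : 0 ≤ a ^ k + a ^ l := add_nonneg (pow_nonneg h0 k) (pow_nonneg h0 l)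
  rcases le_total k l with hkl | hkl
  · exact (count_pow_le_of_le h0 h1 hkl hln h).trans
      (mul_le_mul_of_nonneg_right (by linarith) hp)
  · have := (count_pow_le_of_le h0 h1 hkl hkn (by omega)).trans
      (mul_le_mul_of_nonneg_right (by linarith : 4 * ((k : ℝ) * (n - k)) ≤ 4 * D)
        (by linarith : 0 ≤ a ^ l + a ^ k))
    rw [add_comm (a ^ k), add_comm ((k : ℝ) * a ^ k)]
    exact this

/-- The relative loss of a branch weight under a gate on two sites with different labels. -/
noncomputable def branchLoss (a : ℝ) : ℝ := 2 / 5 * ((a - 1 / 2) * (2 - a)) / a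

/-! ### One averaged step on the branch weights -/

/-- The loss is exact for a `keep`/`swap` pair, where a - (2/5)(1 + a²) = (2/5)(a - 1/2)(2 - a). The
remaining cases only need inequality. -/
theorem pairWeight_le_branchLoss {a : ℝ} (h0 : 1 / 2 ≤ a) (h1 : a ≤ 1) (l l' : Label) :
    pairWeight 1 a l l' ≤ (1 - branchLoss a * if l ≠ l' then 1 else 0) *
        (siteWeight 1 a 1 l * siteWeight 1 a 1 l') ∧
    pairWeight a 1 l l' ≤ (1 - branchLoss a * if l ≠ l' then 1 else 0) *
        (siteWeight a 1 1 l * siteWeight a 1 1 l') := by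
  have ha : 0 < a := by linarith
  have hca : branchLoss a * a = 2 / 5 * ((a - 1 / 2) * (2 - a)) := by
    rw [branchLoss]; field_simp
  have hc : branchLoss a ≤ (2 - a) / 5 := by
    rw [branchLoss, div_le_iff₀ ha]; nlinarith
  cases l <;> cases l' <;>
    simp only [pairWeight, keepCoeff, swapCoeff, Label.trace, Label.swapTrace, siteWeight, ne_eq,
      reduceCtorEq, not_true_eq_false, not_false_eq_true, if_true, if_false] <;>
    constructor <;> nlinarith

/-- At b = (1 + a)/3 every case reduces to (2a - 1)(2 - a) ≥ 0. For larger b, with q = (1 + a)/(3b),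
the true factor is at most q to the number of `diag` sites. It is weakened to a function linear in
that number, so that the average over pairs is explicit. -/
theorem pairWeight_le_isDiag {a b : ℝ} (h0 : 1 / 2 ≤ a) (h1 : a ≤ 1) (hb : (1 + a) / 3 ≤ b)
    (l l' : Label) :
    pairWeight 1 a l l' ≤ (1 - (1 - (1 + a) / 3 / b) / 2 * (isDiag l + isDiag l')) *
        (siteWeight 1 a b l * siteWeight 1 a b l') ∧
    pairWeight a 1 l l' ≤ (1 - (1 - (1 + a) / 3 / b) / 2 * (isDiag l + isDiag l')) *
        (siteWeight a 1 b l * siteWeight a 1 b l') := by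
  have hb0 : 0 < b := by linarith
  obtain ⟨q, hq⟩ : ∃ q, q = (1 + a) / 3 / b := ⟨_, rfl⟩
  have hqb : q * b = (1 + a) / 3 := by rw [hq]; field_simp
  rw [← hq]
  have h2 : 0 ≤ (2 * a - 1) * (2 - a) := mul_nonneg (by linarith) (by linarith)
  have h3 : (1 + a) / 3 * b ≤ b * b := mul_le_mul_of_nonneg_right hb hb0.le
  have h4 : (1 + a) / 3 * ((1 + a) / 3) ≤ (1 + a) / 3 * b :=
    mul_le_mul_of_nonneg_left hb (by linarith)
  have h5 : q * b * b = (1 + a) / 3 * b := by rw [hqb]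
  have h6 : q * b * a = (1 + a) / 3 * a := by rw [hqb]
  have h7 : (1 + a) / 3 * a ≤ b * a := mul_le_mul_of_nonneg_right hb (by linarith)
  cases l <;> cases l' <;>
    simp only [pairWeight, keepCoeff, swapCoeff, Label.trace, Label.swapTrace, siteWeight,
      isDiag] <;>
    constructor <;> nlinarith

/-- Bernoulli's inequality bounds the cost of lowering a to a', and `count_pow_le` pays for it with
the mean loss on unequal pairs. The admissible decrement is logistic in a. -/
theorem labelValue_succ_le_branchWeight {n : ℕ} (hn : 2 ≤ n) {s : ℕ} {a a' : ℝ}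
    (h0 : 1 / 2 ≤ a) (h1 : a ≤ 1) (h0' : 0 ≤ a')
    (hstep : a - a' ≤ (a - 1 / 2) * (1 - a) / (5 * n))
    (hs : ∀ σ, labelValue n s σ ≤ branchWeight a 1 σ) (σ : Fin n → Label) :
    labelValue n (s + 1) σ ≤ branchWeight a' 1 σ := by
  have ha : 0 < a := by linarith
  have hcount := count_add σ
  have hone : ∀ l : Label, l ≠ .diag → count l σ = n → labelValue n (s + 1) σ = 1 := by
    intro l hl h
    rw [eq_const_of_count h]
    exact labelValue_const hn _ hl
  rw [branchWeight_eq, one_pow, mul_one]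
  set k := count .swap σ with hk
  set l := count .keep σ with hl
  -- In the absorbing configurations no pair is unequal and there is no loss to use; the value is
  -- exactly 1, covered by the branch with exponent 0.
  by_cases hkn : k = n
  · rw [hone .swap (by decide) hkn, show l = 0 by omega, pow_zero]
    linarith [pow_nonneg h0' k]
  by_cases hln : l = n
  · rw [hone .keep (by decide) hln, show k = 0 by omega, pow_zero]
    linarith [pow_nonneg h0' l]
  have hsteple := labelValue_succ_le s hs (σ := σ)
    (κ := fun p => 1 - branchLoss a * if σ p.1.1 ≠ σ p.1.2 then 1 else 0) fun p =>
    pairStep_branchWeight_le (ne_of_lt p.2) ha.le zero_le_one σ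
      (pairWeight_le_branchLoss h0 h1 _ _).1 (pairWeight_le_branchLoss h0 h1 _ _).2
  refine hsteple.trans ?_
  set D : ℝ := ∑ p : QubitPair n, if σ p.1.1 ≠ σ p.1.2 then (1 : ℝ) else 0 with hD
  have hDk : (k : ℝ) * (n - k) ≤ D := count_mul_le_sum_ne .swap σ
  have hDl : (l : ℝ) * (n - l) ≤ D := count_mul_le_sum_ne .keep σ
  have hpow := count_pow_le ha.le h1 (n := n) (k := k) (l := l) (by omega) (by omega) (by omega)
    hDk hDl
  have hn' : (2 : ℝ) ≤ n := by exact_mod_cast hn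
  have hcard : (Fintype.card (QubitPair n) : ℝ) = n * (n - 1) / 2 := by
    linarith [two_mul_card_qubitPair n]
  have hcard0 : (0 : ℝ) < n * (n - 1) / 2 :=
    div_pos (mul_pos (by linarith) (by linarith)) two_pos
  rw [branchWeight_eq, one_pow, mul_one, Finset.sum_sub_distrib, ← Finset.mul_sum, ← hD,
    Finset.sum_const, Finset.card_univ, nsmul_eq_mul, mul_one, hcard, ← hk, ← hl, mul_sub,
    inv_mul_cancel₀ hcard0.ne', sub_mul, one_mul]
  obtain ⟨ε, hε⟩ : ∃ ε, ε = (a - a') / a := ⟨_, rfl⟩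
  have hεa : ε * a = a - a' := by rw [hε]; field_simp
  have hbern : ∀ m : ℕ, a ^ m - ε * (m * a ^ m) ≤ a' ^ m := by
    intro m
    have h2 : ε ≤ 1 := by rw [hε, div_le_one ha]; linarith
    have h3 := one_add_mul_le_pow (show -2 ≤ -ε by linarith) m
    have h4 : a' ^ m = (1 + -ε) ^ m * a ^ m := by
      rw [← mul_pow]; congr 1; linear_combination hεa
    rw [h4]
    linarith [mul_le_mul_of_nonneg_right h3 (pow_nonneg ha.le m)]
  have hloss0 : 0 ≤ branchLoss a := by
    rw [branchLoss]
    exact div_nonneg (mul_nonneg (by norm_num)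
      (mul_nonneg (by linarith) (by linarith))) ha.le
  have hεle : ε ≤ branchLoss a * (1 - a) / (2 * n) := by
    rw [hε, div_le_iff₀ ha]
    have : branchLoss a * (1 - a) / (2 * n) * a =
        (a - 1 / 2) * (1 - a) / (5 * n) * (2 - a) := by
      rw [branchLoss]; field_simp
    rw [this]
    have h2 : 0 ≤ (a - 1 / 2) * (1 - a) / (5 * n) :=
      div_nonneg (mul_nonneg (by linarith) (by linarith)) (by positivity)
    nlinarith
  set S : ℝ := k * a ^ k + l * a ^ l with hS
  have hS0 : 0 ≤ S := by positivity
  have hkey : ε * S ≤ (n * (n - 1) / 2 : ℝ)⁻¹ * (branchLoss a * D) * (a ^ k + a ^ l) := by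
    calc ε * S ≤ branchLoss a * (1 - a) / (2 * n) * S := mul_le_mul_of_nonneg_right hεle hS0
      _ = branchLoss a / (2 * n * n) * ((1 - a) * (n * S)) := by field_simp
      _ ≤ branchLoss a / (2 * n * n) * (4 * D * (a ^ k + a ^ l)) :=
          mul_le_mul_of_nonneg_left hpow (by positivity)
      _ = (n * n / 2 : ℝ)⁻¹ * (branchLoss a * D * (a ^ k + a ^ l)) := by field_simp; ring
      _ ≤ (n * (n - 1) / 2 : ℝ)⁻¹ * (branchLoss a * D * (a ^ k + a ^ l)) := by
          have hD0 : 0 ≤ D := Finset.sum_nonneg fun p _ => by split_ifs <;> norm_num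
          refine mul_le_mul_of_nonneg_right ?_ (by positivity)
          exact inv_anti₀ hcard0 (by nlinarith)
      _ = _ := by ring
  linarith [hbern k, hbern l]

/-- A step contributes the mean factor 1 - (1 - q)m/n for m `diag` sites, and Bernoulli turns it
into an m-th power, hence into a new base b. -/
theorem labelValue_succ_le_branchWeight_diag {n : ℕ} (hn : 2 ≤ n) {s : ℕ} {a b : ℝ}
    (h0 : 1 / 2 ≤ a) (h1 : a ≤ 1) (hb : (1 + a) / 3 ≤ b)
    (hs : ∀ σ, labelValue n s σ ≤ branchWeight a b σ) (σ : Fin n → Label) :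
    labelValue n (s + 1) σ ≤ branchWeight a (b - (b - (1 + a) / 3) / n) σ := by
  have ha : 0 ≤ a := by linarith
  have hb0 : 0 < b := by linarith
  have hn' : (2 : ℝ) ≤ n := by exact_mod_cast hn
  have hcard : (0 : ℝ) < Fintype.card (QubitPair n) := by exact_mod_cast card_qubitPair_pos hn
  obtain ⟨q, hq⟩ : ∃ q, q = (1 + a) / 3 / b := ⟨_, rfl⟩
  have hqb : q * b = (1 + a) / 3 := by rw [hq]; field_simp
  have hsteple := labelValue_succ_le s hs (σ := σ)
    (κ := fun p => 1 - (1 - (1 + a) / 3 / b) / 2 * (isDiag (σ p.1.1) + isDiag (σ p.1.2))) fun p =>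
    pairStep_branchWeight_le (ne_of_lt p.2) ha hb0.le σ
      (pairWeight_le_isDiag h0 h1 hb _ _).1 (pairWeight_le_isDiag h0 h1 hb _ _).2
  refine hsteple.trans ?_
  have hmean := mean_isDiag hn σ
  rw [← hq, Finset.sum_sub_distrib, ← Finset.mul_sum, Finset.sum_const, Finset.card_univ,
    nsmul_eq_mul, mul_one, mul_sub, inv_mul_cancel₀ hcard.ne', mul_left_comm, hmean,
    branchWeight_eq, branchWeight_eq]
  set m := count .diag σ
  have hq0 : 0 ≤ q := by rw [hq]; positivity
  have hbern := one_add_mul_le_pow (a := -((1 - q) / n)) (by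
    have : (1 - q) / n ≤ 1 := by rw [div_le_one (by linarith)]; linarith
    linarith) m
  have hpow : (b - (b - (1 + a) / 3) / n) ^ m = (1 + -((1 - q) / n)) ^ m * b ^ m := by
    rw [← mul_pow, ← hqb]; congr 1; ring
  rw [hpow]
  have := mul_le_mul_of_nonneg_right hbern
    (mul_nonneg (add_nonneg (pow_nonneg ha (count .swap σ)) (pow_nonneg ha (count .keep σ)))
      (pow_nonneg hb0.le m))
  calc _ = (1 + m * -((1 - q) / n)) * ((a ^ count .swap σ + a ^ count .keep σ) * b ^ m) := by
        ring
    _ ≤ _ := this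
    _ = _ := by ring

/-- The base of the branch weights that bound the expectations, as a function of a parameter that
grows geometrically with the size of the circuit. -/
noncomputable def branchBase (u : ℝ) : ℝ := 1 / 2 + 1 / (2 * (1 + u))

/-! ### Iteration of the one-step bounds -/

theorem half_le_branchBase {u : ℝ} (hu : 0 ≤ u) : 1 / 2 ≤ branchBase u := by
  have : 0 ≤ 1 / (2 * (1 + u)) := by positivity
  unfold branchBase; linarith

theorem branchBase_le_one {u : ℝ} (hu : 0 ≤ u) : branchBase u ≤ 1 := by
  have : 1 / (2 * (1 + u)) ≤ 1 / 2 := by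
    apply one_div_le_one_div_of_le <;> linarith
  unfold branchBase; linarith

/-- `branchBase` solves the logistic equation da = -(a - 1/2)(1 - a)/(5n) when u grows at rate
1/(10n). The discrete step decreases a slightly less than the equation allows. -/
theorem labelValue_le_branchBase {n : ℕ} (hn : 2 ≤ n) (s : ℕ) (σ : Fin n → Label) :
    labelValue n s σ ≤ branchWeight (branchBase (2 / n * (1 + 1 / (10 * n)) ^ s)) 1 σ := by
  have hn' : (2 : ℝ) ≤ n := by exact_mod_cast hn
  have hn0 : (0 : ℝ) < n := by linarith
  induction s generalizing σ with
  | zero =>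
    -- The start u = 2/n makes a = 1 - 1/(n+2), close enough to 1 that a^k + a^l ≥ 1 whenever k + l
    -- ≤ n.
    have hbase : branchBase (2 / n * (1 + 1 / (10 * n)) ^ 0) = 1 + -(1 / (n + 2)) := by
      rw [branchBase, pow_zero, mul_one]; field_simp; ring
    have h2 : (1 : ℝ) / (n + 2) ≤ 1 := by rw [div_le_one (by linarith)]; linarith
    rw [hbase, branchWeight_eq, one_pow, mul_one, labelValue]
    have hb : ∀ m : ℕ, 1 + (m : ℝ) * -(1 / (n + 2)) ≤ (1 + -(1 / (n + 2) : ℝ)) ^ m := fun m =>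
      one_add_mul_le_pow (by linarith) m
    have hc : (count .swap σ : ℝ) + count .keep σ ≤ n := by
      have := count_add σ
      exact_mod_cast (by omega : count .swap σ + count .keep σ ≤ n)
    have h3 : ((count .swap σ : ℝ) + count .keep σ) * (1 / (n + 2)) ≤ 1 := by
      rw [mul_one_div, div_le_one (by linarith)]; linarith
    linarith [hb (count .swap σ), hb (count .keep σ)]
  | succ s ih =>
    obtain ⟨u, hu⟩ : ∃ u : ℝ, u = 2 / n * (1 + 1 / (10 * n)) ^ s := ⟨_, rfl⟩
    have hu0 : 0 ≤ u := by rw [hu]; positivity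
    rw [← hu] at ih
    have e : (2 : ℝ) / n * (1 + 1 / (10 * n)) ^ (s + 1) = u * (1 + 1 / (10 * n)) := by
      rw [hu, pow_succ]; ring
    rw [e]
    have hu1 : 0 ≤ u * (1 + 1 / (10 * n)) := by positivity
    refine labelValue_succ_le_branchWeight hn (half_le_branchBase hu0) (branchBase_le_one hu0)
      (by linarith [half_le_branchBase hu1]) ?_ ih σ
    have hle : 1 + u ≤ 1 + u * (1 + 1 / (10 * n)) := by
      have : 0 ≤ u * (1 / (10 * n)) := by positivity
      linarith
    have e1 : branchBase u - branchBase (u * (1 + 1 / (10 * n))) =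
        u / (20 * n) / ((1 + u) * (1 + u * (1 + 1 / (10 * n)))) := by
      rw [branchBase, branchBase]; field_simp; ring
    have e2 : (branchBase u - 1 / 2) * (1 - branchBase u) / (5 * n) =
        u / (20 * n) / ((1 + u) * (1 + u)) := by
      rw [branchBase]; field_simp; ring
    rw [e1, e2]
    exact div_le_div_of_nonneg_left (by positivity) (by positivity)
      (mul_le_mul_of_nonneg_left hle (by positivity))

theorem labelValue_add_le {n : ℕ} (hn : 2 ≤ n) {s : ℕ} {a : ℝ} (h0 : 1 / 2 ≤ a) (h1 : a ≤ 1)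
    (hs : ∀ σ, labelValue n s σ ≤ branchWeight a 1 σ) (t : ℕ) (σ : Fin n → Label) :
    labelValue n (s + t) σ ≤
      branchWeight a ((1 + a) / 3 + (2 - a) / 3 * (1 - 1 / n) ^ t) σ := by
  have hn' : (2 : ℝ) ≤ n := by exact_mod_cast hn
  induction t generalizing σ with
  | zero =>
    have e : (1 + a) / 3 + (2 - a) / 3 * (1 - 1 / (n : ℝ)) ^ 0 = 1 := by rw [pow_zero]; ring
    rw [e]
    exact hs σ
  | succ t ih =>
    have hp : (0 : ℝ) ≤ (2 - a) / 3 * (1 - 1 / n) ^ t := by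
      refine mul_nonneg (by linarith) (pow_nonneg ?_ _)
      rw [sub_nonneg, div_le_one (by linarith)]; linarith
    have := labelValue_succ_le_branchWeight_diag hn h0 h1 (by linarith) ih σ
    rw [← add_assoc]
    convert this using 2
    rw [pow_succ]; ring

theorem labelValue_diag_le {n : ℕ} (hn : 2 ≤ n) {s t : ℕ} (hs : 40 * n * Real.log n ≤ s)
    (ht : n * Real.log n ≤ t) : labelValue n (s + t) (fun _ => .diag) ≤ 29 / 2 ^ n := by
  have hn' : (2 : ℝ) ≤ n := by exact_mod_cast hn
  have hn0 : (0 : ℝ) < n := by linarith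
  obtain ⟨u, hu⟩ : ∃ u : ℝ, u = 2 / n * (1 + 1 / (10 * n)) ^ s := ⟨_, rfl⟩
  have hu0 : 0 ≤ u := by rw [hu]; positivity
  have hun : n ≤ u := by
    obtain ⟨x, hx⟩ : ∃ x : ℝ, x = 1 / (10 * n) := ⟨_, rfl⟩
    have hx0 : 0 ≤ x := by rw [hx]; positivity
    have hx1 : x ≤ 1 := by rw [hx, div_le_one (by positivity)]; linarith
    -- Hence (1 + x)^s ≥ e^(s/(20n)), and 40 n log n gates give n², lifting u from 2/n above n.
    have h1 : Real.exp (x / 2) ≤ 1 + x := by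
      have h := Real.add_one_le_exp (-(x / 2))
      have h2 : Real.exp (x / 2) * Real.exp (-(x / 2)) = 1 := by rw [← Real.exp_add]; simp
      have h3 : Real.exp (x / 2) * (-(x / 2) + 1) ≤ 1 :=
        (mul_le_mul_of_nonneg_left h (Real.exp_pos _).le).trans h2.le
      have h4 : (1 : ℝ) ≤ (1 + x) * (-(x / 2) + 1) := by nlinarith
      exact le_of_mul_le_mul_right (h3.trans h4) (by linarith)
    have h2 : (n : ℝ) ^ 2 ≤ (1 + x) ^ s := by
      calc (n : ℝ) ^ 2 = Real.exp (2 * Real.log n) := by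
            rw [two_mul, Real.exp_add, Real.exp_log hn0, sq]
        _ ≤ Real.exp (s * (x / 2)) := by
            rw [Real.exp_le_exp, hx]
            have : (s : ℝ) * (1 / (10 * n) / 2) = s / (20 * n) := by field_simp; ring
            rw [this, le_div_iff₀ (by positivity)]
            linarith
        _ = Real.exp (x / 2) ^ s := Real.exp_nat_mul _ _
        _ ≤ _ := pow_le_pow_left₀ (Real.exp_pos _).le h1 s
    rw [hu, ← hx]
    calc (n : ℝ) ≤ 2 / n * n ^ 2 := by field_simp; norm_num
      _ ≤ _ := mul_le_mul_of_nonneg_left h2 (by positivity)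
  obtain ⟨y, hy⟩ : ∃ y : ℝ, y = (1 - 1 / n) ^ t := ⟨_, rfl⟩
  have h1n : (0 : ℝ) ≤ 1 - 1 / n := by
    rw [sub_nonneg, div_le_one hn0]; linarith
  have hy0 : 0 ≤ y := by rw [hy]; exact pow_nonneg h1n t
  have hy1 : y ≤ 1 / n := by
    calc y ≤ Real.exp (-(1 / n)) ^ t := by
          rw [hy]
          exact pow_le_pow_left₀ h1n (by linarith [Real.add_one_le_exp (-(1 / n : ℝ))]) t
      _ = Real.exp (t * -(1 / n)) := (Real.exp_nat_mul _ _).symm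
      _ ≤ Real.exp (-Real.log n) := by
          rw [Real.exp_le_exp, mul_neg, neg_le_neg_iff, mul_one_div, le_div_iff₀ hn0]
          linarith
      _ = 1 / n := by rw [Real.exp_neg, Real.exp_log hn0, one_div]
  have hmain := labelValue_add_le hn (half_le_branchBase hu0) (branchBase_le_one hu0)
    (fun σ => by rw [hu]; exact labelValue_le_branchBase hn s σ) t fun _ => .diag
  rw [← hy] at hmain
  have c : ∀ l : Label, l ≠ .diag → count l (fun _ : Fin n => Label.diag) = 0 := fun l hl => by
    simp [count, hl.symm]
  have c' : count .diag (fun _ : Fin n => Label.diag) = n := by simp [count]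
  rw [branchWeight_eq, c .keep (by decide), c .swap (by decide), c', pow_zero] at hmain
  have hbase : branchBase u ≤ 1 / 2 + 1 / (2 * n) := by
    have : 1 / (2 * (1 + u)) ≤ 1 / (2 * (n : ℝ)) :=
      one_div_le_one_div_of_le (by positivity) (by linarith)
    unfold branchBase; linarith
  have hhalf := half_le_branchBase hu0
  -- Both errors are O(1/n): a exceeds 1/2 by at most 1/(2n), and the transient is at most 1/(2n).
  have hb : (1 + branchBase u) / 3 + (2 - branchBase u) / 3 * y ≤ (2 / n + 1) / 2 := by
    have h1 : (2 - branchBase u) / 3 * y ≤ 1 / 2 * (1 / n) :=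
      mul_le_mul (by linarith) hy1 hy0 (by norm_num)
    have h2 : 1 / (2 * (n : ℝ)) = 1 / 2 * (1 / n) := by field_simp
    have h3 : (2 : ℝ) / n = 2 * (1 / n) := by ring
    have h4 : (0 : ℝ) < 1 / n := by positivity
    rw [h2] at hbase
    rw [h3]
    linarith
  have hb0 : 0 ≤ (1 + branchBase u) / 3 + (2 - branchBase u) / 3 * y := by
    have := branchBase_le_one hu0
    exact add_nonneg (by linarith) (mul_nonneg (by linarith) hy0)
  refine hmain.trans ?_
  have hexp : (2 / (n : ℝ) + 1) ^ n ≤ 29 / 2 := by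
    calc (2 / (n : ℝ) + 1) ^ n ≤ Real.exp (2 / n) ^ n :=
          pow_le_pow_left₀ (by positivity) (Real.add_one_le_exp _) n
      _ = Real.exp 1 * Real.exp 1 := by
          rw [← Real.exp_nat_mul, ← Real.exp_add]; congr 1; field_simp; norm_num
      _ ≤ 3 * 3 := by
          have := Real.exp_one_lt_three.le
          exact mul_le_mul this this (Real.exp_pos _).le (by norm_num)
      _ ≤ 29 / 2 := by norm_num
  calc _ ≤ (1 + 1) * ((2 / (n : ℝ) + 1) / 2) ^ n :=
        mul_le_mul_of_nonneg_left (pow_le_pow_left₀ hb0 hb n) (by norm_num)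
    _ = 2 * (2 / (n : ℝ) + 1) ^ n / 2 ^ n := by rw [div_pow]; ring
    _ ≤ 29 / 2 ^ n := by gcongr; linarith

/-! ### Numerical estimate for the lower bound -/

theorem rpow_le_mul_pow {n : ℕ} (hn : 2 ≤ n) {s : ℕ} {c : ℝ} (hc : 3 ≤ c)
    (hs : (s : ℝ) ≤ 1 / (3 * c) * n * Real.log n) :
    (n : ℝ) ^ (1 - 1 / c) ≤ n * (1 - 2 / n) ^ s := by
  have hn' : (2 : ℝ) ≤ n := by exact_mod_cast hn
  have hn0 : (0 : ℝ) < n := by linarith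
  have hc0 : 0 < c := by linarith
  have hlog : 0 ≤ Real.log n := Real.log_nonneg (by linarith)
  -- From n = 6 on, (1 - 2/n)(1 + 3/n) ≥ 1 and so 1 - 2/n ≥ e^(-3/n). For n ≤ 5, n log n ≤ 8.2 < 9 ≤
  -- 3c forces s = 0.
  rcases lt_or_ge n 6 with h6 | h6
  · have hs0 : s = 0 := by
      have h5 : (n : ℝ) ≤ 5 := by exact_mod_cast (by omega : n ≤ 5)
      have hl5 : Real.log n ≤ 1.64 := by
        have e : (5 : ℝ) = 2 * 2 * (5 / 4) := by norm_num
        have h := Real.log_le_log hn0 h5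
        rw [e, Real.log_mul (by norm_num) (by norm_num),
          Real.log_mul (by norm_num) (by norm_num)] at h
        have := Real.log_le_sub_one_of_pos (show (0 : ℝ) < 5 / 4 by norm_num)
        have := Real.log_two_lt_d9
        linarith
      have h1 : (n : ℝ) * Real.log n ≤ 5 * 1.64 := mul_le_mul h5 hl5 hlog (by norm_num)
      have h2 : 1 / (3 * c) * n * Real.log n < 1 := by
        rw [mul_assoc, one_div_mul_eq_div, div_lt_one (by positivity)]
        norm_num at h1 ⊢
        linarith
      have h3 : (s : ℝ) < 1 := lt_of_le_of_lt hs h2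
      exact Nat.lt_one_iff.1 (by exact_mod_cast h3)
    rw [hs0, pow_zero, mul_one]
    calc (n : ℝ) ^ (1 - 1 / c) ≤ (n : ℝ) ^ (1 : ℝ) := by
          refine Real.rpow_le_rpow_of_exponent_le (by linarith) ?_
          have : 0 < 1 / c := by positivity
          linarith
      _ = n := Real.rpow_one _
  · have h6' : (6 : ℝ) ≤ n := by exact_mod_cast h6
    have h1 : Real.exp (-(3 / n)) ≤ 1 - 2 / n := by
      have h2 : Real.exp (-(3 / (n : ℝ))) * Real.exp (3 / n) = 1 := by
        rw [← Real.exp_add]; simp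
      have h3 := Real.add_one_le_exp (3 / (n : ℝ))
      have h4 : (1 : ℝ) ≤ (1 - 2 / n) * (3 / n + 1) := by
        have : (1 - 2 / (n : ℝ)) * (3 / n + 1) = 1 + (n - 6) / n ^ 2 := by field_simp; ring
        rw [this]
        have : 0 ≤ ((n : ℝ) - 6) / n ^ 2 := div_nonneg (by linarith) (by positivity)
        linarith
      have h5 : 0 ≤ 1 - 2 / (n : ℝ) := by
        rw [sub_nonneg, div_le_one hn0]; exact hn'
      refine le_of_mul_le_mul_right ?_ (Real.exp_pos (3 / (n : ℝ)))
      rw [h2]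
      exact h4.trans (mul_le_mul_of_nonneg_left h3 h5)
    calc (n : ℝ) ^ (1 - 1 / c) = n * Real.exp (Real.log n * -(1 / c)) := by
          rw [sub_eq_add_neg, Real.rpow_add hn0, Real.rpow_one, Real.rpow_def_of_pos hn0]
      _ ≤ n * Real.exp (s * -(3 / n)) := by
          refine mul_le_mul_of_nonneg_left (Real.exp_le_exp.2 ?_) hn0.le
          have : (s : ℝ) * (3 / n) ≤ 1 / (3 * c) * n * Real.log n * (3 / n) :=
            mul_le_mul_of_nonneg_right hs (by positivity)
          have e : 1 / (3 * c) * n * Real.log n * (3 / n) = Real.log n * (1 / c) := by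
            field_simp
          linarith
      _ = n * Real.exp (-(3 / n)) ^ s := by rw [Real.exp_nat_mul]
      _ ≤ _ := mul_le_mul_of_nonneg_left
          (pow_le_pow_left₀ (Real.exp_pos _).le h1 s) hn0.le

end RandomCircuit

theorem theorem5 :
    (∃ c : ℝ, 0 < c ∧ ∀ n s : ℕ, 2 ≤ n →
      c * n * Real.log n ^ 2 < s →
        RandomCircuit.expectedColl n s ≤ 29 / 2 ^ n) ∧
    (∃ c₀ : ℝ, 0 < c₀ ∧ ∀ c' : ℝ, c₀ ≤ c' → ∀ n s : ℕ, 2 ≤ n →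
      (s : ℝ) ≤ 1 / (3 * c') * n * Real.log n →
        (1.6 : ℝ) ^ ((n : ℝ) ^ (1 - 1 / c')) / 2 ^ n ≤ RandomCircuit.expectedColl n s) := by
  -- Since log n ≥ 0.69, the hypothesis with 200 gives s > 138 n log n, so each half of the circuit
  -- has at least 40 n log n gates, enough for either stage. The value 3 is what the case n ≤ 5 of
  -- the lower bound requires.
  refine ⟨⟨200, by norm_num, fun n s hn hs => ?_⟩, ⟨3, by norm_num, fun c' hc n s hn hs => ?_⟩⟩
  · rw [RandomCircuit.expectedColl_eq hn]
    have hn' : (2 : ℝ) ≤ n := by exact_mod_cast hn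
    have hl2 := Real.log_two_gt_d9
    have hl : 0.69 ≤ Real.log n := by
      have := Real.log_le_log two_pos hn'
      norm_num at hl2 ⊢
      linarith
    have h1 : (1.38 : ℝ) ≤ n * Real.log n := by
      have := mul_le_mul hn' hl (by norm_num) (by linarith)
      norm_num at this ⊢
      linarith
    have h2 : 138 * (n * Real.log n) < s := by
      have h3 := mul_le_mul_of_nonneg_right hl (by linarith : 0 ≤ (n : ℝ) * Real.log n)
      nlinarith
    have h3 : (s : ℝ) ≤ 2 * (s / 2 : ℕ) + 1 := by
      exact_mod_cast (by omega : s ≤ 2 * (s / 2) + 1)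
    have h4 : ((s / 2 : ℕ) : ℝ) ≤ (s - s / 2 : ℕ) := by
      exact_mod_cast (by omega : s / 2 ≤ s - s / 2)
    have h5 : 40 * n * Real.log n ≤ (s / 2 : ℕ) := by
      norm_num at h1
      linarith
    have := RandomCircuit.labelValue_diag_le hn h5 (t := s - s / 2) (by linarith)
    rwa [Nat.add_sub_of_le (Nat.div_le_self s 2)] at this
  · rw [RandomCircuit.expectedColl_eq hn]
    refine le_trans ?_ (RandomCircuit.two_rpow_le_labelValue hn s)
    refine div_le_div_of_nonneg_right ?_ (by positivity)
    calc (1.6 : ℝ) ^ ((n : ℝ) ^ (1 - 1 / c')) ≤ 2 ^ ((n : ℝ) ^ (1 - 1 / c')) :=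
          Real.rpow_le_rpow (by norm_num) (by norm_num) (by positivity)
      _ ≤ _ := Real.rpow_le_rpow_of_exponent_le one_le_two
          (RandomCircuit.rpow_le_mul_pow hn hc hs)
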